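/- **Setting.** We work in negation-free Temporal Datalog over a vocabulary of constants and predicate symbols. A time term is an integer constant or an expression $T+k$ with $T$ a time variable and $k\in\mathbb Z$; the temporal sort is $\mathbb Z$. A temporal predicate has exactly one time argument, a rigid predicate has none. A program $\Pi$ is a set of safe rules $\bigwedge_i\alpha_i\to\alpha$ (every variable of the head occurs in the body). A predicate is intensional (IDB) if it occurs in the head of a rule with non-empty body, and extensional (EDB) otherwise. A query is a pair $Q=\langle P,\Pi\rangle$ with $P$ an IDB atom. $Q$ is connected if each rule contains at most one time variable, which occurs in the head whenever it occurs in the body. A data stream $D$ is a set of ground EDB atoms whose timestamps are natural numbers; $D_\tau$ is the set of its temporal facts with timestamp at most $\tau$ (so $D_{-1}=\emptyset$). $\models$ is truth in all Herbrand models. Substitutions have finite support. **Supported answers.** A hypothetical answer to $Q$ over $D_\tau$ is a pair $\langle\sigma,H\rangle$ with $\sigma$ a ground substitution whose support is $\mathrm{var}(P)$ and $H$ a finite set of ground EDB temporal atoms with timestamps $>\tau$, such that $\Pi\cup D_\tau\cup H\models P\sigma$ and $H$ is minimal (for inclusion) with this property. A supported answer is a triple $\langle\sigma,H,E\rangle\in\mathcal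 E(Q,D,\tau)$ where $\langle\sigma,H\rangle$ is a hypothetical answer and $E\subseteq D_\tau$ is non-empty and minimal among the sets $E'$ with $\Pi\cup E'\cup H\models P\sigma$. **Preconditions.** A computed answer with premises over the empty history is a pair $\langle\theta,A\rangle$ for which there is a finite SLD-derivation from the goal $\neg P$ with clauses of $\Pi$ such that: every mgu maps the variables of its support to terms whose variables occur in the selected goal atom; the set of atoms of the last goal is $A$, and they all are EDB temporal atoms whose time term contains a variable or is a constant $\ge 0$; and $\theta$ is the composition of the mgus restricted to $\mathrm{var}(P)$. It is minimal if there is no computed answer with premises $\langle\theta,A'\rangle$ with $A'\subsetneq A$. A set of preconditions $\mathcal P_Q$ consists of triples $\langle\theta,M,A\setminus M\rangle$ where $\langle\theta,A\rangle$ is a minimal computed answer with premises and $M$ is the set of atoms of $A$ with minimal timestamp, and contains such a triple for each minimal computed answer with premises, up to a change of variables (two pairs $\langle\theta,A\rangle$ being identified if each is an instance of the other). **Algorithm.** Let $\mathcal S_{-1}=\emptyset$. For $\tau\ge-1$, $\mathcal S_{\tau+1}$ consists of the following triples: 1. for each $\langle\theta,M,F\rangle\in\mathcal P_Q$ and each computed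 answer $\sigma$ to $(D_{\tau+1}\setminus D_\tau)\cup\{\neg\bigwedge M\}$, the triple $\langle\theta\sigma,M\sigma,F\sigma\rangle$; 2. for each $\langle\theta,E,H\rangle\in\mathcal S_\tau$, with $M\subseteq H$ the set of its atoms with timestamp $\tau+1$, and each computed answer $\sigma$ to $(D_{\tau+1}\setminus D_\tau)\cup\{\neg\bigwedge M\}$, the triple $\langle\theta\sigma,(E\cup M)\sigma,(H\setminus M)\sigma\rangle$. **Proposition (Completeness).** Let $Q=\langle P,\Pi\rangle$ be a connected query such that, for each minimal computed answer with premises $\langle\theta,A\rangle$ over the empty history, either all timestamps in $A$ are constants or all of them contain a time variable (so that "minimal timestamp" is meaningful). Let $\mathcal P_Q$ be a set of preconditions for $Q$, let $D$ be a data stream and $\tau\in\mathbb N$. If $\langle\sigma,H,E\rangle\in\mathcal E(Q,D,\tau)$, then there exist a substitution $\rho$ and a triple $\langle\theta,E',H'\rangle\in\mathcal S_\tau$ such that $\sigma=(\theta\rho)|_{\mathrm{var}(P)}$, $H=H'\rho$ and $E=E'\rho$. -/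

import Mathlib

namespace TemporalDatalog

universe u v

/-- A vocabulary: constants of the object sort and predicate symbols. Every predicate has a number
of object arguments and is either temporal (it has one further, temporal, argument) or rigid. -/
structure Signature where
  Const : Type u
  Pred : Type v
  arity : Pred → ℕ
  temporal : Pred → Bool

/-- Variables of the two sorts. -/
inductive Var where
  | obj (x : ℕ)
  | time (T : ℕ)

/-- Object terms. -/
inductive OTerm (C : Type*) where
  | const (c : C)
  | var (x : ℕ)

/-- Time terms: a time constant, or `T + k` with `k` an integer (the variable `T` is `T + 0`).
The temporal sort is closed under addition of arbitrary integers. -/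
inductive TTerm where
  | const (z : ℤ)
  | shift (T : ℕ) (k : ℤ)

/-- The term `t + k`, with additions of constants computed. -/
def TTerm.add : TTerm → ℤ → TTerm
  | .const z, k => .const (z + k)
  | .shift T j, k => .shift T (j + k)

def OTerm.vars {C : Type*} : OTerm C → Set Var
  | .const _ => ∅
  | .var x => {Var.obj x}

def TTerm.vars : TTerm → Set Var
  | .const _ => ∅
  | .shift T _ => {Var.time T}

/-- Substitutions: sort-preserving maps from variables to terms, with finite support. -/
@[ext]
structure Subst (C : Type*) where
  obj : ℕ → OTerm C
  time : ℕ → TTerm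
  finite_obj : {x | obj x ≠ .var x}.Finite
  finite_time : {T | time T ≠ .shift T 0}.Finite

def OTerm.subst {C : Type*} (t : OTerm C) (σ : Subst C) : OTerm C :=
  match t with
  | .const c => .const c
  | .var x => σ.obj x

def TTerm.subst {C : Type*} (t : TTerm) (σ : Subst C) : TTerm :=
  match t with
  | .const z => .const z
  | .shift T k => (σ.time T).add k

namespace Subst

variable {C : Type*}

/-- The identity (empty) substitution. -/
def id : Subst C where
  obj := .var
  time := fun T => .shift T 0
  finite_obj := by simp
  finite_time := by simp

/-- The variables in the term that `σ` assigns to `v`. -/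
def imageVars (σ : Subst C) : Var → Set Var
  | .obj x => (σ.obj x).vars
  | .time T => (σ.time T).vars

/-- The support: the variables that are not mapped to themselves. -/
def supp (σ : Subst C) : Set Var :=
  {v | match v with
    | .obj x => σ.obj x ≠ .var x
    | .time T => σ.time T ≠ .shift T 0}

/-- Every variable in the support is mapped to a constant. -/
def IsGround (σ : Subst C) : Prop := ∀ v ∈ σ.supp, σ.imageVars v = ∅

/-- Composition `θσ`: first `θ`, then `σ`. -/
def comp (θ σ : Subst C) : Subst C where
  obj := fun x => (θ.obj x).subst σ
  time := fun T => (θ.time T).subst σ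
  finite_obj := by
    refine (θ.finite_obj.union σ.finite_obj).subset fun x hx => ?_
    by_contra h
    simp only [Set.mem_union, Set.mem_ofPred_eq, not_or, not_not] at h
    exact hx (by rw [h.1]; exact h.2)
  finite_time := by
    refine (θ.finite_time.union σ.finite_time).subset fun T hT => ?_
    by_contra h
    simp only [Set.mem_union, Set.mem_ofPred_eq, not_or, not_not] at h
    exact hT (by rw [h.1]; simp [TTerm.subst, h.2, TTerm.add])

open Classical in
/-- The restriction of `σ` to the set `V` of variables. -/
noncomputable def restrict (σ : Subst C) (V : Set Var) : Subst C where
  obj := fun x => if Var.obj x ∈ V then σ.obj x else .var x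
  time := fun T => if Var.time T ∈ V then σ.time T else .shift T 0
  finite_obj := by
    refine σ.finite_obj.subset fun x hx h => hx ?_
    simp [h]
  finite_time := by
    refine σ.finite_time.subset fun T hT h => hT ?_
    simp [h]

/-- A renaming: a permutation of the variables of each sort. -/
def IsRenaming (δ : Subst C) : Prop :=
  (∃ e : Equiv.Perm ℕ, ∀ x, δ.obj x = .var (e x)) ∧
    ∃ e : Equiv.Perm ℕ, ∀ T, δ.time T = .shift (e T) 0

end Subst

/-- Atoms: a predicate symbol applied to the right number of object terms and, exactly if the
predicate is temporal, a time term. -/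
@[ext]
structure Atom (S : Signature) where
  pred : S.Pred
  args : List (OTerm S.Const)
  time : Option TTerm
  length_args : args.length = S.arity pred
  isSome_time : time.isSome = S.temporal pred

namespace Atom

variable {S : Signature}

def vars (a : Atom S) : Set Var :=
  {v | (∃ t ∈ a.args, v ∈ t.vars) ∨ ∃ t ∈ a.time, v ∈ t.vars}

def subst (a : Atom S) (σ : Subst S.Const) : Atom S where
  pred := a.pred
  args := a.args.map fun t => t.subst σ
  time := a.time.map fun t => t.subst σ
  length_args := by simpa using a.length_args
  isSome_time := by simpa using a.isSome_time

/-- Ground atoms. As additions are computed on substituting, ground atoms are the facts. -/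
def IsGround (a : Atom S) : Prop := a.vars = ∅

/-- The atom has the time constant `z` as its timestamp. -/
def HasTimestamp (a : Atom S) (z : ℤ) : Prop := a.time = some (.const z)

/-- Future atoms with respect to `τ`: temporal atoms whose time term contains a variable or is a
time constant larger than `τ`. -/
def IsFuture (a : Atom S) (τ : ℤ) : Prop :=
  (∃ T k, a.time = some (.shift T k)) ∨ ∃ z, a.HasTimestamp z ∧ τ < z

/-- The timestamps of `a` and `b` are comparable, and that of `a` is at most that of `b`. -/
def TimeLE (a b : Atom S) : Prop :=
  (∃ z w, a.time = some (.const z) ∧ b.time = some (.const w) ∧ z ≤ w) ∨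
    ∃ T k l, a.time = some (.shift T k) ∧ b.time = some (.shift T l) ∧ k ≤ l

end Atom

/-- `A σ` for a set of atoms `A`. -/
def substSet {S : Signature} (A : Set (Atom S)) (σ : Subst S.Const) : Set (Atom S) :=
  (fun a => a.subst σ) '' A

/-- The variables of a goal (or of the body of a rule). -/
def goalVars {S : Signature} (G : List (Atom S)) : Set Var := {v | ∃ a ∈ G, v ∈ a.vars}

/-- Rules `body → head`. -/
structure Rule (S : Signature) where
  body : List (Atom S)
  head : Atom S

namespace Rule

variable {S : Signature}

def vars (r : Rule S) : Set Var := goalVars r.body ∪ r.head.vars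

def subst (r : Rule S) (σ : Subst S.Const) : Rule S where
  body := r.body.map fun a => a.subst σ
  head := r.head.subst σ

/-- Each variable in the head occurs in the body. -/
def Safe (r : Rule S) : Prop := r.head.vars ⊆ goalVars r.body

/-- There is at most one temporal variable, and it occurs in the head if it occurs in the body. -/
def Connected (r : Rule S) : Prop :=
  (∀ T T', Var.time T ∈ r.vars → Var.time T' ∈ r.vars → T = T') ∧
    ∀ T, Var.time T ∈ goalVars r.body → Var.time T ∈ r.head.vars

end Rule

variable {S : Signature}

/-- A predicate is intensional if it occurs in the head of a rule with non-empty body. -/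
def IsIDB (prog : Set (Rule S)) (p : S.Pred) : Prop :=
  ∃ r ∈ prog, r.body ≠ [] ∧ r.head.pred = p

/-- A predicate is extensional if it is defined only through rules with empty body. -/
def IsEDB (prog : Set (Rule S)) (p : S.Pred) : Prop := ¬ IsIDB prog p

/-! ### Semantics -/

/-- The Herbrand interpretation `I` satisfies all ground instances of the rules. -/
def IsModel (I : Set (Atom S)) (prog : Set (Rule S)) : Prop :=
  ∀ r ∈ prog, ∀ σ : Subst S.Const, (r.subst σ).vars = ∅ →
    (∀ b ∈ (r.subst σ).body, b ∈ I) → (r.subst σ).head ∈ I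

/-- `prog ∪ F ⊨ a` for a set of facts `F` and a ground atom `a`: truth in all Herbrand models. -/
def Entails (prog : Set (Rule S)) (F : Set (Atom S)) (a : Atom S) : Prop :=
  ∀ I : Set (Atom S), (∀ b ∈ I, b.IsGround) → IsModel I prog → F ⊆ I → a ∈ I

/-- A query: a program of safe rules together with an intensional atom. -/
structure Query (S : Signature) where
  prog : Set (Rule S)
  safe : ∀ r ∈ prog, r.Safe
  atom : Atom S
  idb : IsIDB prog atom.pred

def Query.Connected (Q : Query S) : Prop := ∀ r ∈ Q.prog, r.Connected

/-- Datasets (data streams): sets of extensional facts; timestamps are natural numbers. -/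
def IsDataset (prog : Set (Rule S)) (D : Set (Atom S)) : Prop :=
  ∀ a ∈ D, a.IsGround ∧ IsEDB prog a.pred ∧ ∀ z, a.HasTimestamp z → 0 ≤ z

/-- The `τ`-history of `D`: the facts in `D` whose temporal argument is at most `τ`. -/
def history (D : Set (Atom S)) (τ : ℤ) : Set (Atom S) :=
  {a | a ∈ D ∧ ∃ z, a.HasTimestamp z ∧ z ≤ τ}

/-- `⟨θ, H⟩` is a hypothetical answer to `Q` over the `τ`-history of `D`. -/
structure IsHypotheticalAnswer (Q : Query S) (D : Set (Atom S)) (τ : ℤ)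
    (θ : Subst S.Const) (H : Set (Atom S)) : Prop where
  ground : θ.IsGround
  supp_eq : θ.supp = Q.atom.vars
  finite : H.Finite
  edb : ∀ a ∈ H, a.IsGround ∧ IsEDB Q.prog a.pred
  future : ∀ a ∈ H, ∃ z, a.HasTimestamp z ∧ τ < z
  entails : Entails Q.prog (history D τ ∪ H) (Q.atom.subst θ)
  minimal : ∀ H' ⊆ H, Entails Q.prog (history D τ ∪ H') (Q.atom.subst θ) → H' = H

/-- `⟨θ, H, E⟩` is a supported answer to `Q` over the `τ`-history of `D`. -/
structure IsSupportedAnswer (Q : Query S) (D : Set (Atom S)) (τ : ℤ)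
    (θ : Subst S.Const) (H E : Set (Atom S)) : Prop where
  hypothetical : IsHypotheticalAnswer Q D τ θ H
  nonempty : E.Nonempty
  subset : E ⊆ history D τ
  entails : Entails Q.prog (E ∪ H) (Q.atom.subst θ)
  minimal : ∀ E' ⊆ E, Entails Q.prog (E' ∪ H) (Q.atom.subst θ) → E' = E

/-! ### SLD-resolution -/

/-- `θ` is a most general unifier of `a` and `b`. -/
def IsMGU (θ : Subst S.Const) (a b : Atom S) : Prop :=
  a.subst θ = b.subst θ ∧
    ∀ σ : Subst S.Const, a.subst σ = b.subst σ → ∃ γ : Subst S.Const, σ = θ.comp γ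

/-- `G'` is the resolvent, using the mgu `θ`, of the goal `G` and a renaming of a clause of `P`
that shares no variable with `G`. As usual for this language, only mgus whose terms use no other
variables than those of the selected atom are considered. -/
def Resolves (P : Set (Rule S)) (G : List (Atom S)) (θ : Subst S.Const) (G' : List (Atom S)) :
    Prop :=
  ∃ r ∈ P, ∃ δ : Subst S.Const, δ.IsRenaming ∧ Disjoint (goalVars G) (r.subst δ).vars ∧
    ∃ (L R : List (Atom S)) (a : Atom S), G = L ++ a :: R ∧
      IsMGU θ a (r.subst δ).head ∧
      (∀ v ∈ θ.supp, θ.imageVars v ⊆ a.vars) ∧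
      G' = (L ++ (r.subst δ).body ++ R).map fun b => b.subst θ

/-- `Derives P G θ G'`: there is a finite SLD-derivation from `G` to `G'` with clauses from `P`,
and `θ` is the composition of its mgus. -/
inductive Derives (P : Set (Rule S)) (G : List (Atom S)) :
    Subst S.Const → List (Atom S) → Prop
  | refl : Derives P G Subst.id G
  | step {θ θ' : Subst S.Const} {G' G'' : List (Atom S)} :
      Derives P G θ G' → Resolves P G' θ' G'' → Derives P G (θ.comp θ') G''

/-- Facts as clauses with empty body. -/
def factRules (F : Set (Atom S)) : Set (Rule S) := (fun a => ⟨[], a⟩) '' F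

/-- `σ` is a computed answer to `P ∪ {¬ ⋀ G}`. -/
def IsComputedAnswer (P : Set (Rule S)) (G : List (Atom S)) (σ : Subst S.Const) : Prop :=
  ∃ θ, Derives P G θ [] ∧ σ = θ.restrict (goalVars G)

/-- `σ` is a computed answer to `P ∪ {¬ ⋀ M}`, where the finite set `M` is listed as a goal. -/
def IsComputedAnswerSet (P : Set (Rule S)) (M : Set (Atom S)) (σ : Subst S.Const) : Prop :=
  ∃ G : List (Atom S), G.Nodup ∧ {a | a ∈ G} = M ∧ IsComputedAnswer P G σ

/-- `⟨θ, ⋀ A⟩` is a computed answer with premises to `Q` over the `τ`-history of `D`. -/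
def IsComputedWithPremises (Q : Query S) (D : Set (Atom S)) (τ : ℤ)
    (θ : Subst S.Const) (A : Set (Atom S)) : Prop :=
  ∃ (θ' : Subst S.Const) (G : List (Atom S)),
    Derives (Q.prog ∪ factRules (history D τ)) [Q.atom] θ' G ∧
      (∀ a ∈ G, a.IsFuture τ ∧ IsEDB Q.prog a.pred) ∧
      θ = θ'.restrict Q.atom.vars ∧ A = {a | a ∈ G}

/-! ### The incremental algorithm -/

/-- `⟨θ, ⋀ A⟩` is a computed answer with premises over the empty history, and `A` is minimal among
the sets of premises computed with `θ`. -/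
def IsMinimalComputed (Q : Query S) (θ : Subst S.Const) (A : Set (Atom S)) : Prop :=
  IsComputedWithPremises Q ∅ (-1) θ A ∧
    ∀ A' ⊆ A, IsComputedWithPremises Q ∅ (-1) θ A' → A' = A

/-- No minimal set of premises mixes constant timestamps with timestamps that contain a variable.
(Otherwise "minimal timestamp" has no meaning for it.) -/
def Query.UnmixedPremises (Q : Query S) : Prop :=
  ∀ θ A, IsMinimalComputed Q θ A →
    (∀ a ∈ A, ∃ z, a.time = some (.const z)) ∨ ∀ a ∈ A, ∃ T k, a.time = some (.shift T k)

/-- The elements of `A` with minimal timestamp. -/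
def earliest (A : Set (Atom S)) : Set (Atom S) := {a | a ∈ A ∧ ∀ b ∈ A, a.TimeLE b}

/-- Triples of a substitution and two sets of atoms: preconditions `⟨θ, M, F⟩` and schematic
supported answers `⟨θ, E, H⟩`. -/
structure Triple (S : Signature) where
  subst : Subst S.Const
  fst : Set (Atom S)
  snd : Set (Atom S)

/-- `⟨θ, A⟩` and `⟨θ', A'⟩` are equal up to a change of variables: each is an instance of the
other. -/
def IsVariant (Q : Query S) (θ : Subst S.Const) (A : Set (Atom S))
    (θ' : Subst S.Const) (A' : Set (Atom S)) : Prop :=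
  (∃ δ : Subst S.Const, θ' = (θ.comp δ).restrict Q.atom.vars ∧ A' = substSet A δ) ∧
    ∃ δ : Subst S.Const, θ = (θ'.comp δ).restrict Q.atom.vars ∧ A = substSet A' δ

/-- `PQ` is a set of preconditions for `Q`: it consists of entries `⟨θ, M, A \ M⟩`, with `M` the
elements of `A` with minimal timestamp, for minimal computed answers with premises `⟨θ, A⟩` over
the empty history, and has such an entry for each of them, up to a change of variables. -/
def IsPreconditionSet (Q : Query S) (PQ : Set (Triple S)) : Prop :=
  (∀ p ∈ PQ, ∃ θ A, IsMinimalComputed Q θ A ∧ p = ⟨θ, earliest A, A \ earliest A⟩) ∧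
    ∀ θ A, IsMinimalComputed Q θ A → ∃ θ' A', IsMinimalComputed Q θ' A' ∧
      IsVariant Q θ A θ' A' ∧ (⟨θ', earliest A', A' \ earliest A'⟩ : Triple S) ∈ PQ

/-- One round of the algorithm: from `PQ`, the previous set `prev` and the facts `F` that arrive at
time `t`, the two steps compute the next set of schematic supported answers. -/
def round (PQ prev : Set (Triple S)) (F : Set (Atom S)) (t : ℤ) : Set (Triple S) :=
  {s | ∃ p ∈ PQ, ∃ σ, IsComputedAnswerSet (factRules F) p.fst σ ∧
      s = ⟨p.subst.comp σ, substSet p.fst σ, substSet p.snd σ⟩} ∪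
  {s | ∃ p ∈ prev, ∃ M, M = {a | a ∈ p.snd ∧ a.HasTimestamp t} ∧
      ∃ σ, IsComputedAnswerSet (factRules F) M σ ∧
        s = ⟨p.subst.comp σ, substSet (p.fst ∪ M) σ, substSet (p.snd \ M) σ⟩}

/-- The set of schematic supported answers maintained at time `τ`; it is empty before time `0`. -/
def schematic (PQ : Set (Triple S)) (D : Set (Atom S)) : ℕ → Set (Triple S)
  | 0 => round PQ ∅ (history D 0 \ history D (-1)) 0
  | n + 1 => round PQ (schematic PQ D n) (history D (n + 1) \ history D n) (n + 1)

end TemporalDatalog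

/-!
A supported answer `⟨σ, H, E⟩` is found by the algorithm in the form of one schematic answer and
one substitution `γ`, which stays the same during the whole run.

*From semantics to preconditions.* The ground atoms with a top-down proof from `E ∪ H` form a
Herbrand model, so `Pσ` has such a proof (`Entails.exists_reflTransGen_instanceStep`). By the
lifting lemma `exists_derives_of_reflTransGen` the proof is an instance, under some `γ`, of an
SLD-derivation from `P`; its last goal consists of premises. Lifting needs most general unifiers
that use no variables other than those of the selected atom. All terms are flat, and time terms can
be shifted by arbitrary integers, so that solving the equations one by one, always binding the
variable of the rule where there is a choice, provides them (`Atom.exists_solves`). Among the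
computed sets of premises for the same substitution a minimal one `A` is chosen inside the one just
found. SLD-resolution is sound, so the facts `Aγ ⊆ E ∪ H` still entail `Pσ`, and as `E` and `H` are
minimal this forces `Aγ = E ∪ H` (`IsSupportedAnswer.exists_precondition`).

*From preconditions to the run.* Put `L = E ∪ H`. For a connected query only one time variable
occurs in the premises, since resolution with a connected rule creates no new one. Hence `γ` maps
the premises with minimal timestamp exactly to the facts of `L` with the least timestamp `n`, and
`n ≤ τ` because `E` is non-empty. At time `n` the precondition is matched with these facts; the
computed answer is `γ` restricted to the variables of the matched premises
(`isComputedAnswerSet_restrict`). Composing it with `γ` gives `γ` again, so nothing is lost, and from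
then on all time terms are constants. Each further round moves the facts of `L` that carry the
current timestamp from the hypothetical part to the evidence; the invariant is `Tracks`. At time `τ`
the evidence is the part of `L` up to `τ`, which is `E`, and the rest is `H`.
-/

namespace TemporalDatalog

variable {C : Type*} {S : Signature}

/-! ### Substitutions -/

theorem TTerm.add_add (t : TTerm) (j k : ℤ) : (t.add j).add k = t.add (j + k) := by
  cases t <;> simp [TTerm.add, _root_.add_assoc]

theorem TTerm.add_zero (t : TTerm) : t.add 0 = t := by
  cases t <;> simp [TTerm.add]

theorem TTerm.add_injective (k : ℤ) : Function.Injective fun t : TTerm => t.add k := by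
  intro s t h
  have := congrArg (fun t => TTerm.add t (-k)) h
  simpa [TTerm.add_add, TTerm.add_zero] using this

theorem TTerm.add_subst (t : TTerm) (k : ℤ) (σ : Subst C) :
    (t.add k).subst σ = (t.subst σ).add k := by
  cases t with
  | const z => rfl
  | shift T j => exact (TTerm.add_add _ _ _).symm

theorem TTerm.vars_add (t : TTerm) (k : ℤ) : (t.add k).vars = t.vars := by
  cases t <;> rfl

theorem OTerm.subst_comp (t : OTerm C) (θ σ : Subst C) :
    t.subst (θ.comp σ) = (t.subst θ).subst σ := by
  cases t <;> rfl

theorem TTerm.subst_comp (t : TTerm) (θ σ : Subst C) :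
    t.subst (θ.comp σ) = (t.subst θ).subst σ := by
  cases t with
  | const z => rfl
  | shift T k => exact (TTerm.add_subst _ _ _).symm

theorem OTerm.subst_id (t : OTerm C) : t.subst Subst.id = t := by
  cases t <;> rfl

theorem TTerm.subst_id (t : TTerm) : t.subst (Subst.id : Subst C) = t := by
  cases t <;> simp [TTerm.subst, Subst.id, TTerm.add]

theorem Atom.subst_comp (a : Atom S) (θ σ : Subst S.Const) :
    a.subst (θ.comp σ) = (a.subst θ).subst σ := by
  ext1
  · rfl
  · simp [Atom.subst, OTerm.subst_comp]
  · simp [Atom.subst, TTerm.subst_comp, Function.comp_def]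

theorem Atom.subst_id (a : Atom S) : a.subst Subst.id = a := by
  ext1
  · rfl
  · simp [Atom.subst, OTerm.subst_id]
  · simp [Atom.subst, TTerm.subst_id]

theorem Rule.subst_comp (r : Rule S) (θ σ : Subst S.Const) :
    r.subst (θ.comp σ) = (r.subst θ).subst σ := by
  simp [Rule.subst, Atom.subst_comp]

theorem substSet_comp (A : Set (Atom S)) (θ σ : Subst S.Const) :
    substSet A (θ.comp σ) = substSet (substSet A θ) σ := by
  simp [substSet, Set.image_image, Atom.subst_comp]

namespace Subst

theorem comp_assoc (θ σ τ : Subst C) : (θ.comp σ).comp τ = θ.comp (σ.comp τ) := by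
  ext1
  · funext x
    exact (OTerm.subst_comp _ _ _).symm
  · funext T
    exact (TTerm.subst_comp _ _ _).symm

theorem id_comp (σ : Subst C) : Subst.id.comp σ = σ := by
  ext1
  · rfl
  · funext T
    exact TTerm.add_zero _

/-- `σ` and `τ` assign the same terms to the variables in `V`. -/
def AgreeOn (σ τ : Subst C) (V : Set Var) : Prop :=
  (∀ x, Var.obj x ∈ V → σ.obj x = τ.obj x) ∧ ∀ T, Var.time T ∈ V → σ.time T = τ.time T

theorem AgreeOn.mono {σ τ : Subst C} {V W : Set Var} (h : σ.AgreeOn τ V) (hW : W ⊆ V) :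
    σ.AgreeOn τ W :=
  ⟨fun x hx => h.1 x (hW hx), fun T hT => h.2 T (hW hT)⟩

theorem AgreeOn.symm {σ τ : Subst C} {V : Set Var} (h : σ.AgreeOn τ V) : τ.AgreeOn σ V :=
  ⟨fun x hx => (h.1 x hx).symm, fun T hT => (h.2 T hT).symm⟩

theorem AgreeOn.trans {σ τ υ : Subst C} {V : Set Var} (h : σ.AgreeOn τ V)
    (h' : τ.AgreeOn υ V) : σ.AgreeOn υ V :=
  ⟨fun x hx => (h.1 x hx).trans (h'.1 x hx), fun T hT => (h.2 T hT).trans (h'.2 T hT)⟩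

theorem AgreeOn.comp {σ τ : Subst C} {V : Set Var} (h : σ.AgreeOn τ V) (γ : Subst C) :
    (σ.comp γ).AgreeOn (τ.comp γ) V :=
  ⟨fun x hx => by simp [Subst.comp, h.1 x hx], fun T hT => by simp [Subst.comp, h.2 T hT]⟩

theorem agreeOn_restrict (σ : Subst C) (V : Set Var) : (σ.restrict V).AgreeOn σ V :=
  ⟨fun x hx => by simp [restrict, hx], fun T hT => by simp [restrict, hT]⟩

theorem restrict_congr {σ τ : Subst C} {V : Set Var} (h : σ.AgreeOn τ V) :
    σ.restrict V = τ.restrict V := by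
  ext1
  · funext x
    by_cases hx : Var.obj x ∈ V
    · simp [restrict, hx, h.1 x hx]
    · simp [restrict, hx]
  · funext T
    by_cases hT : Var.time T ∈ V
    · simp [restrict, hT, h.2 T hT]
    · simp [restrict, hT]

theorem restrict_supp (σ : Subst C) : σ.restrict σ.supp = σ := by
  ext1
  · funext x
    by_cases hx : σ.obj x = .var x <;> simp [restrict, supp, hx]
  · funext T
    by_cases hT : σ.time T = .shift T 0 <;> simp [restrict, supp, hT]

end Subst

theorem OTerm.subst_congr {t : OTerm C} {σ τ : Subst C} (h : σ.AgreeOn τ t.vars) :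
    t.subst σ = t.subst τ := by
  cases t with
  | const c => rfl
  | var x => exact h.1 x rfl

theorem TTerm.subst_congr {t : TTerm} {σ τ : Subst C} (h : σ.AgreeOn τ t.vars) :
    t.subst σ = t.subst τ := by
  cases t with
  | const z => rfl
  | shift T k => exact congrArg (fun t => TTerm.add t k) (h.2 T rfl)

theorem Atom.subst_congr {a : Atom S} {σ τ : Subst S.Const} (h : σ.AgreeOn τ a.vars) :
    a.subst σ = a.subst τ := by
  ext1
  · rfl
  · refine List.map_congr_left fun t ht => OTerm.subst_congr (h.mono ?_)
    exact fun v hv => Or.inl ⟨t, ht, hv⟩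
  · refine Option.map_congr fun t ht => TTerm.subst_congr (h.mono ?_)
    exact fun v hv => Or.inr ⟨t, ht, hv⟩

/-- A substitution is determined on the variables of an atom by the instance it produces. -/
theorem Subst.AgreeOn.of_atom_subst_eq {a : Atom S} {σ τ : Subst S.Const}
    (h : a.subst σ = a.subst τ) : σ.AgreeOn τ a.vars := by
  have hargs : ∀ t ∈ a.args, t.subst σ = t.subst τ := List.map_inj_left.mp (congrArg Atom.args h)
  have htime : ∀ t ∈ a.time, t.subst σ = t.subst τ := by
    intro t ht
    have := congrArg Atom.time h
    rw [Option.mem_def] at ht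
    simpa [Atom.subst, ht] using this
  constructor
  · rintro x (⟨t, ht, hx⟩ | ⟨t, ht, hx⟩)
    · cases t with
      | const c => exact hx.elim
      | var y =>
        cases hx
        exact hargs _ ht
    · cases t with
      | const c => exact hx.elim
      | shift T k => cases hx
  · rintro T (⟨t, ht, hT⟩ | ⟨t, ht, hT⟩)
    · cases t with
      | const c => exact hT.elim
      | var y => cases hT
    · cases t with
      | const c => exact hT.elim
      | shift T' k =>
        cases hT
        exact TTerm.add_injective k (htime _ ht)

theorem OTerm.mem_vars_subst {t : OTerm C} {σ : Subst C} {v : Var} :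
    v ∈ (t.subst σ).vars ↔ ∃ w ∈ t.vars, v ∈ σ.imageVars w := by
  cases t <;> simp [OTerm.subst, OTerm.vars, Subst.imageVars]

theorem TTerm.mem_vars_subst {t : TTerm} {σ : Subst C} {v : Var} :
    v ∈ (t.subst σ).vars ↔ ∃ w ∈ t.vars, v ∈ σ.imageVars w := by
  cases t with
  | const z => simp [TTerm.subst, TTerm.vars]
  | shift T k => simp [TTerm.subst, TTerm.vars_add, Subst.imageVars, TTerm.vars.eq_2 T k]

theorem Atom.mem_vars_subst {a : Atom S} {σ : Subst S.Const} {v : Var} :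
    v ∈ (a.subst σ).vars ↔ ∃ w ∈ a.vars, v ∈ σ.imageVars w := by
  constructor
  · rintro (⟨t, ht, hv⟩ | ⟨t, ht, hv⟩)
    · obtain ⟨s, hs, rfl⟩ := List.mem_map.mp ht
      obtain ⟨w, hw, hvw⟩ := OTerm.mem_vars_subst.mp hv
      exact ⟨w, Or.inl ⟨s, hs, hw⟩, hvw⟩
    · obtain ⟨s, hs, rfl⟩ := Option.map_eq_some_iff.mp ht
      obtain ⟨w, hw, hvw⟩ := TTerm.mem_vars_subst.mp hv
      exact ⟨w, Or.inr ⟨s, hs, hw⟩, hvw⟩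
  · rintro ⟨w, ⟨t, ht, hw⟩ | ⟨t, ht, hw⟩, hv⟩
    · exact Or.inl ⟨_, List.mem_map_of_mem ht, OTerm.mem_vars_subst.mpr ⟨w, hw, hv⟩⟩
    · exact Or.inr ⟨_, Option.map_eq_some_iff.mpr ⟨t, ht, rfl⟩,
        TTerm.mem_vars_subst.mpr ⟨w, hw, hv⟩⟩

theorem mem_goalVars_map_subst {G : List (Atom S)} {σ : Subst S.Const} {v : Var} :
    v ∈ goalVars (G.map fun a => a.subst σ) ↔ ∃ w ∈ goalVars G, v ∈ σ.imageVars w := by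
  simp only [goalVars, List.mem_map, Set.mem_ofPred_eq]
  constructor
  · rintro ⟨_, ⟨a, ha, rfl⟩, hv⟩
    obtain ⟨w, hw, hv⟩ := Atom.mem_vars_subst.mp hv
    exact ⟨w, ⟨a, ha, hw⟩, hv⟩
  · rintro ⟨w, ⟨a, ha, hw⟩, hv⟩
    exact ⟨_, ⟨a, ha, rfl⟩, Atom.mem_vars_subst.mpr ⟨w, hw, hv⟩⟩

theorem Rule.mem_vars_subst {r : Rule S} {σ : Subst S.Const} {v : Var} :
    v ∈ (r.subst σ).vars ↔ ∃ w ∈ r.vars, v ∈ σ.imageVars w := by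
  simp only [Rule.vars, Rule.subst, Set.mem_union, mem_goalVars_map_subst, Atom.mem_vars_subst,
    or_and_right, exists_or]

theorem Rule.Safe.subst {r : Rule S} (h : r.Safe) (σ : Subst S.Const) : (r.subst σ).Safe := by
  intro v hv
  obtain ⟨w, hw, hv⟩ := Atom.mem_vars_subst.mp hv
  exact mem_goalVars_map_subst.mpr ⟨w, h hw, hv⟩

theorem OTerm.finite_vars (t : OTerm C) : t.vars.Finite := by
  cases t <;> simp [OTerm.vars]

theorem TTerm.finite_vars (t : TTerm) : t.vars.Finite := by
  cases t <;> simp [TTerm.vars]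

theorem Subst.finite_imageVars (σ : Subst C) (v : Var) : (σ.imageVars v).Finite := by
  cases v
  · exact OTerm.finite_vars _
  · exact TTerm.finite_vars _

theorem Atom.finite_vars (a : Atom S) : a.vars.Finite := by
  have h1 : (⋃ t ∈ {t | t ∈ a.args}, t.vars).Finite :=
    (List.finite_toSet a.args).biUnion fun t _ => t.finite_vars
  have h2 : (⋃ t ∈ {t | t ∈ a.time}, t.vars).Finite :=
    (Set.Subsingleton.finite fun s hs t ht => Option.mem_unique hs ht).biUnion
      fun t _ => t.finite_vars
  refine (h1.union h2).subset ?_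
  rintro v (⟨t, ht, hv⟩ | ⟨t, ht, hv⟩)
  · exact Or.inl (Set.mem_biUnion ht hv)
  · exact Or.inr (Set.mem_biUnion ht hv)

theorem finite_goalVars (G : List (Atom S)) : (goalVars G).Finite := by
  have h : (⋃ a ∈ {a | a ∈ G}, a.vars).Finite :=
    (List.finite_toSet G).biUnion fun a _ => a.finite_vars
  refine h.subset ?_
  rintro v ⟨a, ha, hv⟩
  exact Set.mem_biUnion ha hv

theorem Rule.finite_vars (r : Rule S) : r.vars.Finite :=
  (finite_goalVars _).union (Atom.finite_vars _)

/-! ### Most general unifiers -/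

namespace Subst

/-- The variables in the support are mapped to terms with variables in `V`. -/
def ImagesIn (θ : Subst C) (V : Set Var) : Prop := ∀ v ∈ θ.supp, θ.imageVars v ⊆ V

/-- `θ` is an idempotent most general solution of the unification problem `U` whose terms only
use variables from `V`. Being most general is expressed by `θσ = σ` for every solution `σ`, which
is the form that composes. -/
structure Solves (V : Set Var) (U : Subst C → Prop) (θ : Subst C) : Prop where
  images : θ.ImagesIn V
  solution : U θ
  comp_eq : ∀ σ, U σ → θ.comp σ = σ

theorem imageVars_comp {θ σ : Subst C} {v w : Var} :
    w ∈ (θ.comp σ).imageVars v ↔ ∃ u ∈ θ.imageVars v, w ∈ σ.imageVars u := by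
  cases v
  · exact OTerm.mem_vars_subst
  · exact TTerm.mem_vars_subst

theorem imageVars_of_notMem_supp {θ : Subst C} {v : Var} (h : v ∉ θ.supp) :
    θ.imageVars v = {v} := by
  cases v <;> simp_all [supp, imageVars, OTerm.vars, TTerm.vars]

theorem comp_mem_supp {θ σ : Subst C} {v : Var} (h : v ∈ (θ.comp σ).supp) :
    v ∈ θ.supp ∨ v ∈ σ.supp := by
  by_contra! hv
  cases v <;> simp_all [supp, comp, OTerm.subst, TTerm.subst, TTerm.add]

theorem ImagesIn.comp {θ σ : Subst C} {V : Set Var} (hθ : θ.ImagesIn V) (hσ : σ.ImagesIn V) :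
    (θ.comp σ).ImagesIn V := by
  intro v hv w hw
  obtain ⟨u, hu, hw⟩ := imageVars_comp.mp hw
  by_cases hu' : u ∈ σ.supp
  · exact hσ u hu' hw
  · rw [imageVars_of_notMem_supp hu', Set.mem_singleton_iff] at hw
    subst hw
    by_cases hvθ : v ∈ θ.supp
    · exact hθ v hvθ hu
    · rw [imageVars_of_notMem_supp hvθ, Set.mem_singleton_iff] at hu
      subst hu
      exact absurd ((comp_mem_supp hv).resolve_left hvθ) hu'

/-- Unification problems are solved one equation after the other. -/
theorem Solves.comp {V : Set Var} {U₁ U₂ : Subst C → Prop} {θ₁ θ₂ : Subst C}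
    (h₁ : Solves V U₁ θ₁) (hU₁ : U₁ (θ₁.comp θ₂))
    (h₂ : Solves V (fun σ => U₂ (θ₁.comp σ)) θ₂) :
    Solves V (fun σ => U₁ σ ∧ U₂ σ) (θ₁.comp θ₂) where
  images := h₁.images.comp h₂.images
  solution := ⟨hU₁, h₂.solution⟩
  comp_eq := by
    rintro σ ⟨hσ₁, hσ₂⟩
    have h := h₁.comp_eq σ hσ₁
    have h' := h₂.comp_eq σ (by rwa [h])
    rw [comp_assoc, h', h]

theorem solves_id {V : Set Var} {U : Subst C → Prop} (h : U Subst.id) :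
    Solves V U (Subst.id : Subst C) where
  images := by
    intro v hv
    cases v <;> simp [supp, Subst.id] at hv
  solution := h
  comp_eq := fun σ _ => id_comp σ

/-- The substitution `{x ↦ t}` of an object term for an object variable. -/
def bindObj (x : ℕ) (t : OTerm C) : Subst C where
  obj := Function.update .var x t
  time := fun T => .shift T 0
  finite_obj := (Set.finite_singleton x).subset fun y hy => by
    by_contra h
    exact hy (Function.update_of_ne h _ _)
  finite_time := by simp

/-- The substitution `{T ↦ t}` of a time term for a time variable. -/
def bindTime (T : ℕ) (t : TTerm) : Subst C where
  obj := .var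
  time := Function.update (fun T => .shift T 0) T t
  finite_obj := by simp
  finite_time := (Set.finite_singleton T).subset fun y hy => by
    by_contra h
    exact hy (Function.update_of_ne h _ _)

theorem bindObj_imagesIn {V : Set Var} {x : ℕ} {t : OTerm C} (h : t.vars ⊆ V) :
    (bindObj x t).ImagesIn V := by
  rintro (y | T) hv
  · by_cases hy : y = x
    · subst hy
      simpa [imageVars, bindObj] using h
    · simp [supp, bindObj, hy] at hv
  · simp [supp, bindObj] at hv

theorem bindTime_imagesIn {V : Set Var} {T : ℕ} {t : TTerm} (h : t.vars ⊆ V) :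
    (bindTime T t : Subst C).ImagesIn V := by
  rintro (x | T') hv
  · simp [supp, bindTime] at hv
  · by_cases hT : T' = T
    · subst hT
      simpa [imageVars, bindTime] using h
    · simp [supp, bindTime, hT] at hv

theorem bindObj_comp {x : ℕ} {t : OTerm C} {σ : Subst C} (h : t.subst σ = σ.obj x) :
    (bindObj x t).comp σ = σ := by
  ext1
  · funext y
    by_cases hy : y = x
    · subst hy
      simpa [Subst.comp, bindObj] using h
    · simp [Subst.comp, bindObj, hy, OTerm.subst]
  · funext T
    exact TTerm.add_zero _

theorem bindTime_comp {T : ℕ} {t : TTerm} {σ : Subst C} (h : t.subst σ = σ.time T) :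
    (bindTime T t).comp σ = σ := by
  ext1
  · rfl
  · funext T'
    by_cases hT : T' = T
    · subst hT
      simpa [Subst.comp, bindTime] using h
    · simp [Subst.comp, bindTime, hT, TTerm.subst, TTerm.add_zero]

end Subst

open Subst

/-- Unifiable object terms `s` and `t` have a most general unifier that uses no other variables
than those of `s`: an equation between two variables is solved by binding that of `t`. -/
theorem OTerm.exists_solves {V : Set Var} {s t : OTerm C} (hs : s.vars ⊆ V) {σ : Subst C}
    (h : s.subst σ = t.subst σ) : ∃ θ, Solves V (fun σ => s.subst σ = t.subst σ) θ := by
  cases t with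
  | const d =>
    cases s with
    | const c => exact ⟨_, solves_id h⟩
    | var x =>
      refine ⟨bindObj x (.const d), bindObj_imagesIn (by simp [OTerm.vars]), ?_, ?_⟩
      · simp [OTerm.subst, bindObj]
      · intro σ hσ
        exact bindObj_comp hσ.symm
  | var y =>
    refine ⟨bindObj y s, bindObj_imagesIn hs, ?_, fun σ hσ => bindObj_comp hσ⟩
    cases s with
    | const c => simp [OTerm.subst, bindObj]
    | var x =>
      by_cases hxy : x = y
      · simp [hxy]
      · simp [OTerm.subst, bindObj, hxy]

theorem OTerm.exists_solves_list {V : Set Var} :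
    ∀ {ss ts : List (OTerm C)}, (∀ s ∈ ss, s.vars ⊆ V) → ∀ {σ : Subst C},
      (ss.map fun t => t.subst σ) = ts.map (fun t => t.subst σ) →
      ∃ θ, Solves V (fun σ : Subst C =>
        (ss.map fun t => t.subst σ) = ts.map fun t => t.subst σ) θ
  | [], [], _, _, _ => ⟨_, solves_id rfl⟩
  | [], _ :: _, _, _, h => by simp at h
  | _ :: _, [], _, _, h => by simp at h
  | s :: ss, t :: ts, hV, σ, h => by
    simp only [List.map_cons, List.cons.injEq] at h
    obtain ⟨θ₁, h₁⟩ := exists_solves_list (fun s' hs' => hV s' (List.mem_cons_of_mem _ hs')) h.2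
    have hσ := h₁.comp_eq σ h.2
    have hs : (s.subst θ₁).vars ⊆ V := by
      intro v hv
      obtain ⟨w, hw, hv⟩ := OTerm.mem_vars_subst.mp hv
      by_cases hw' : w ∈ θ₁.supp
      · exact h₁.images w hw' hv
      · rw [imageVars_of_notMem_supp hw', Set.mem_singleton_iff] at hv
        exact hv ▸ hV s (by simp) hw
    obtain ⟨θ₂, h₂⟩ := OTerm.exists_solves hs (t := t.subst θ₁) (σ := σ)
      (by rw [← OTerm.subst_comp, ← OTerm.subst_comp, hσ, h.1])
    have := h₁.comp (U₂ := fun σ => s.subst σ = t.subst σ) (θ₂ := θ₂)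
      (by
        have := congrArg (List.map fun t => t.subst θ₂) h₁.solution
        simpa [OTerm.subst_comp, Function.comp_def] using this)
      (by simpa only [OTerm.subst_comp] using h₂)
    exact ⟨_, by simpa only [List.map_cons, List.cons.injEq, and_comm] using this⟩

theorem TTerm.exists_solves {V : Set Var} {s t : TTerm} (hs : s.vars ⊆ V) {σ : Subst C}
    (h : s.subst σ = t.subst σ) :
    ∃ θ, Solves V (fun σ : Subst C => s.subst σ = t.subst σ) θ := by
  have key : ∀ (r : TTerm) (T : ℕ) (k : ℤ) (σ : Subst C), r.subst σ = (shift T k).subst σ →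
      (r.add (-k)).subst σ = σ.time T := by
    intro r T k σ hσ
    rw [TTerm.add_subst, hσ]
    simp [TTerm.subst, TTerm.add_add, TTerm.add_zero]
  cases t with
  | const w =>
    cases s with
    | const z => exact ⟨_, solves_id h⟩
    | shift T k =>
      refine ⟨bindTime T ((const w).add (-k)), bindTime_imagesIn (by simp [TTerm.add, TTerm.vars]),
        ?_, fun σ hσ => bindTime_comp (key _ _ _ _ hσ.symm)⟩
      simp [TTerm.subst, bindTime, TTerm.add]
  | shift T l =>
    cases s with
    | const z =>
      refine ⟨bindTime T ((const z).add (-l)), bindTime_imagesIn (by simp [TTerm.add, TTerm.vars]),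
        ?_, fun σ hσ => bindTime_comp (key _ _ _ _ hσ)⟩
      simp [TTerm.subst, bindTime, TTerm.add]
    | shift T' k =>
      by_cases hT : T' = T
      · subst hT
        have hkl : k = l := by
          cases hσ : σ.time T' <;> simp [TTerm.subst, TTerm.add, hσ] at h <;> exact h
        exact ⟨_, solves_id (by rw [hkl])⟩
      · refine ⟨bindTime T ((shift T' k).add (-l)), bindTime_imagesIn ?_, ?_,
          fun σ hσ => bindTime_comp (key _ _ _ _ hσ)⟩
        · rwa [TTerm.vars_add]
        · simp [TTerm.subst, bindTime, TTerm.add, hT]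

/-- Unifiable atoms have a most general unifier of the kind that SLD-resolution uses. -/
theorem Atom.exists_solves {a b : Atom S} {σ : Subst S.Const} (h : a.subst σ = b.subst σ) :
    ∃ θ, Solves a.vars (fun σ => a.subst σ = b.subst σ) θ := by
  have hpred : a.pred = b.pred := congrArg (fun c => c.pred) h
  have hargs : (a.args.map fun t => t.subst σ) = b.args.map fun t => t.subst σ :=
    congrArg Atom.args h
  have htime : (a.time.map fun t => t.subst σ) = b.time.map fun t => t.subst σ :=
    congrArg Atom.time h
  obtain ⟨θ₁, h₁⟩ := OTerm.exists_solves_list (V := a.vars)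
    (fun s hs v hv => Or.inl ⟨s, hs, hv⟩) hargs
  have hσ := h₁.comp_eq σ hargs
  have hU : ∀ τ : Subst S.Const, a.subst τ = b.subst τ ↔
      ((a.args.map fun t => t.subst τ) = b.args.map fun t => t.subst τ) ∧
        (a.time.map fun t => t.subst τ) = b.time.map fun t => t.subst τ := by
    intro τ
    rw [Atom.ext_iff]
    exact ⟨fun h => h.2, fun h => ⟨hpred, h⟩⟩
  simp only [hU]
  suffices ∃ θ₂, Solves a.vars (fun τ : Subst S.Const =>
      (a.time.map fun t => t.subst (θ₁.comp τ)) = b.time.map fun t => t.subst (θ₁.comp τ)) θ₂ by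
    obtain ⟨θ₂, h₂⟩ := this
    refine ⟨_, h₁.comp (U₂ := fun τ : Subst S.Const => (a.time.map fun t => t.subst τ) =
      b.time.map fun t => t.subst τ) ?_ h₂⟩
    have := congrArg (List.map fun t => t.subst θ₂) h₁.solution
    simpa [OTerm.subst_comp, Function.comp_def] using this
  rcases ha : a.time with _ | s <;> rcases hb : b.time with _ | t <;> rw [ha, hb] at htime
  · exact ⟨_, solves_id rfl⟩
  · simp at htime
  · simp at htime
  · simp only [Option.map_some, Option.some.injEq, TTerm.subst_comp] at htime ⊢
    refine TTerm.exists_solves (σ := σ) ?_ ?_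
    · intro v hv
      obtain ⟨w, hw, hv⟩ := TTerm.mem_vars_subst.mp hv
      by_cases hw' : w ∈ θ₁.supp
      · exact h₁.images w hw' hv
      · rw [imageVars_of_notMem_supp hw', Set.mem_singleton_iff] at hv
        exact hv ▸ Or.inr ⟨s, ha, hw⟩
    · rw [← TTerm.subst_comp, ← TTerm.subst_comp, hσ, htime]

/-! ### Ground derivations -/

/-- One step of a top-down proof at the level of instances: an atom that is the head of an instance
of a rule is replaced by the body of that instance. -/
def InstanceStep (P : Set (Rule S)) (g g' : List (Atom S)) : Prop :=
  ∃ r ∈ P, ∃ σ : Subst S.Const, ∃ L R : List (Atom S),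
    g = L ++ (r.subst σ).head :: R ∧ g' = L ++ (r.subst σ).body ++ R

theorem InstanceStep.append {P : Set (Rule S)} {g g' : List (Atom S)} (h : InstanceStep P g g')
    (K N : List (Atom S)) : InstanceStep P (K ++ g ++ N) (K ++ g' ++ N) := by
  obtain ⟨r, hr, σ, L, R, rfl, rfl⟩ := h
  exact ⟨r, hr, σ, K ++ L, R ++ N, by simp, by simp⟩

theorem reflTransGen_instanceStep_append {P : Set (Rule S)} {g g' : List (Atom S)}
    (h : Relation.ReflTransGen (InstanceStep P) g g') (K N : List (Atom S)) :
    Relation.ReflTransGen (InstanceStep P) (K ++ g ++ N) (K ++ g' ++ N) :=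
  h.lift (fun g => K ++ g ++ N) fun _ _ hs => hs.append K N

/-- If each atom of a goal can be reduced to facts from `F`, then so can the goal. -/
theorem exists_reflTransGen_instanceStep_of_forall {P : Set (Rule S)} {F : Set (Atom S)} :
    ∀ {g : List (Atom S)},
      (∀ a ∈ g, ∃ l : List (Atom S), (∀ b ∈ l, b ∈ F) ∧
        Relation.ReflTransGen (InstanceStep P) [a] l) →
      ∃ l : List (Atom S), (∀ b ∈ l, b ∈ F) ∧ Relation.ReflTransGen (InstanceStep P) g l
  | [], _ => ⟨[], by simp, .refl⟩
  | a :: g, h => by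
    obtain ⟨l, hl, hal⟩ := h a (by simp)
    obtain ⟨l', hl', hgl'⟩ := exists_reflTransGen_instanceStep_of_forall (g := g)
      fun b hb => h b (List.mem_cons_of_mem _ hb)
    refine ⟨l ++ l', ?_, ?_⟩
    · intro b hb
      exact (List.mem_append.mp hb).elim (hl b) (hl' b)
    · have h1 := reflTransGen_instanceStep_append hal [] g
      have h2 := reflTransGen_instanceStep_append hgl' l []
      simp only [List.nil_append, List.append_nil, List.singleton_append] at h1 h2
      exact h1.trans h2

/-- The ground atoms that have a top-down proof from `F` form a Herbrand model, so that every
entailed atom has such a proof. -/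
theorem Entails.exists_reflTransGen_instanceStep {P : Set (Rule S)} {F : Set (Atom S)}
    {a : Atom S} (hF : ∀ b ∈ F, b.IsGround) (h : Entails P F a) :
    ∃ l : List (Atom S), (∀ b ∈ l, b ∈ F) ∧ Relation.ReflTransGen (InstanceStep P) [a] l := by
  refine (h {a | a.IsGround ∧ ∃ l : List (Atom S), (∀ b ∈ l, b ∈ F) ∧
    Relation.ReflTransGen (InstanceStep P) [a] l} (fun b hb => hb.1) ?_ ?_).2
  · intro r hr σ hground hbody
    refine ⟨Set.subset_eq_empty (fun v hv => Or.inr hv) hground, ?_⟩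
    obtain ⟨l, hl, hbl⟩ := exists_reflTransGen_instanceStep_of_forall fun b hb => (hbody b hb).2
    exact ⟨l, hl, .head ⟨r, hr, σ, [], [], by simp, by simp⟩ hbl⟩
  · intro b hb
    exact ⟨hF b hb, [b], by simpa using hb, .refl⟩

/-! ### Lifting to SLD-derivations -/

/-- A position in the enumeration of the variables of the sort of a variable. -/
def Var.index : Var → ℕ
  | .obj x => x
  | .time T => T

/-- The involution that exchanges the intervals `[0, N)` and `[N, 2N)`. -/
def swapBlocks (N x : ℕ) : ℕ := if x < N then x + N else if x < 2 * N then x - N else x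

theorem swapBlocks_involutive (N : ℕ) : Function.Involutive (swapBlocks N) := by
  intro x
  unfold swapBlocks
  grind

/-- Variables can be renamed away from a finite set `W`, and then values for the renamed variables
can be prescribed independently of those for `W`. -/
theorem exists_renaming_apart {W : Set Var} (hW : W.Finite) (γ σ : Subst C) :
    ∃ δ γ' : Subst C, δ.IsRenaming ∧ (∀ v ∈ W, Disjoint (δ.imageVars v) W) ∧
      γ'.AgreeOn γ W ∧ (δ.comp γ').AgreeOn σ W := by
  obtain ⟨N, hN⟩ : ∃ N, ∀ v ∈ W, v.index < N := by
    obtain ⟨N, hN⟩ := (hW.image Var.index).bddAbove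
    exact ⟨N + 1, fun v hv => Nat.lt_succ_of_le (hN (Set.mem_image_of_mem _ hv))⟩
  have hfin : {x | swapBlocks N x ≠ x}.Finite := by
    refine (Set.finite_lt_nat (2 * N)).subset fun x hx => ?_
    simp only [Set.mem_ofPred_eq, swapBlocks] at hx ⊢
    grind
  let δ : Subst C :=
    { obj := fun x => .var (swapBlocks N x)
      time := fun T => .shift (swapBlocks N T) 0
      finite_obj := hfin.subset fun x hx h => hx (by rw [h])
      finite_time := hfin.subset fun x hx h => hx (by rw [h]) }
  let γ' : Subst C :=
    { obj := fun x => if x < N then γ.obj x else if x < 2 * N then σ.obj (x - N) else .var x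
      time := fun T =>
        if T < N then γ.time T else if T < 2 * N then σ.time (T - N) else .shift T 0
      finite_obj := (Set.finite_lt_nat (2 * N)).subset fun x hx => by
        simp only [Set.mem_ofPred_eq] at hx ⊢
        grind
      finite_time := (Set.finite_lt_nat (2 * N)).subset fun x hx => by
        simp only [Set.mem_ofPred_eq] at hx ⊢
        grind }
  refine ⟨δ, γ', ⟨⟨(swapBlocks_involutive N).toPerm, fun x => rfl⟩,
    (swapBlocks_involutive N).toPerm, fun x => rfl⟩, ?_, ⟨?_, ?_⟩, ?_, ?_⟩
  · intro v hv
    rw [Set.disjoint_left]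
    intro w hw hwW
    have h1 := hN v hv
    have h2 := hN w hwW
    cases v <;> cases hw <;> simp only [Var.index, swapBlocks] at h1 h2 <;> grind
  · intro x hx
    exact if_pos (hN _ hx)
  · intro x hx
    exact if_pos (hN _ hx)
  · intro x hx
    have : x < N := hN _ hx
    have h2 : x + N < 2 * N := by omega
    simp [Subst.comp, δ, γ', OTerm.subst, swapBlocks, this, h2]
  · intro x hx
    have : x < N := hN _ hx
    have h2 : x + N < 2 * N := by omega
    simp [Subst.comp, δ, γ', TTerm.subst, swapBlocks, this, h2, TTerm.add_zero]

/-- A step on an instance of the current goal is an instance of an SLD-step. -/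
theorem Derives.lift_instanceStep {P : Set (Rule S)} {G₀ G : List (Atom S)} {θ γ : Subst S.Const}
    {g' : List (Atom S)} {V : Set Var} (hV : V.Finite) (hd : Derives P G₀ θ G)
    (hs : InstanceStep P (G.map fun a => a.subst γ) g') :
    ∃ θ' G' γ', Derives P G₀ θ' G' ∧ g' = (G'.map fun a => a.subst γ') ∧
      (θ'.comp γ').AgreeOn (θ.comp γ) V := by
  obtain ⟨r, hr, σ, L', R', hg, rfl⟩ := hs
  obtain ⟨L, G₁, rfl, rfl, hG₁⟩ := List.map_eq_append_iff.mp hg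
  obtain ⟨a, R, rfl, ha, rfl⟩ := List.map_eq_cons_iff.mp hG₁
  have hWfin : (goalVars (L ++ a :: R) ∪ r.vars ∪ ⋃ v ∈ V, θ.imageVars v).Finite :=
    ((finite_goalVars _).union r.finite_vars).union
      (hV.biUnion fun v _ => θ.finite_imageVars v)
  obtain ⟨δ, γ', hδ, hdisj, hγ, hσ⟩ := exists_renaming_apart hWfin γ σ
  have hGγ : ∀ b ∈ L ++ a :: R, b.subst γ' = b.subst γ := fun b hb =>
    Atom.subst_congr (hγ.mono fun v hv => Or.inl (Or.inl ⟨b, hb, hv⟩))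
  have hhead : (r.subst δ).head.subst γ' = (r.subst σ).head := by
    change (r.head.subst δ).subst γ' = r.head.subst σ
    rw [← Atom.subst_comp]
    exact Atom.subst_congr (hσ.mono fun v hv => Or.inl (Or.inr (Or.inr hv)))
  have hbody : ((r.subst δ).body.map fun b => b.subst γ') = (r.subst σ).body := by
    simp only [Rule.subst, List.map_map]
    refine List.map_congr_left fun b hb => ?_
    rw [Function.comp_apply, ← Atom.subst_comp]
    exact Atom.subst_congr (hσ.mono fun v hv => Or.inl (Or.inr (Or.inl ⟨b, hb, hv⟩)))
  have hunif : a.subst γ' = (r.subst δ).head.subst γ' := by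
    rw [hGγ a (by simp), ha, hhead]
  obtain ⟨θ', hθ'⟩ := Atom.exists_solves hunif
  have hθγ : θ'.comp γ' = γ' := hθ'.comp_eq γ' hunif
  refine ⟨θ.comp θ', _, γ', hd.step ⟨r, hr, δ, hδ, ?_, L, R, a, rfl,
    ⟨hθ'.solution, fun τ hτ => ⟨τ, (hθ'.comp_eq τ hτ).symm⟩⟩, hθ'.images, rfl⟩, ?_, ?_⟩
  · rw [Set.disjoint_left]
    intro v hv hvr
    obtain ⟨w, hw, hvw⟩ := Rule.mem_vars_subst.mp hvr
    exact Set.disjoint_left.mp (hdisj w (Or.inl (Or.inr hw))) hvw (Or.inl (Or.inl hv))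
  · simp only [List.map_map, Function.comp_def, ← Atom.subst_comp, hθγ]
    rw [List.map_append, List.map_append, hbody]
    congr 1
    · congr 1
      exact List.map_congr_left fun b hb => (hGγ b (by simp [hb])).symm
    · exact List.map_congr_left fun b hb => (hGγ b (by simp [hb])).symm
  · rw [comp_assoc, hθγ]
    exact ⟨fun x hx => OTerm.subst_congr (hγ.mono fun v hv => Or.inr (Set.mem_biUnion hx hv)),
      fun T hT => TTerm.subst_congr (hγ.mono fun v hv => Or.inr (Set.mem_biUnion hT hv))⟩

/-- The lifting lemma: a top-down proof of an instance of an atom is an instance of an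
SLD-derivation. -/
theorem exists_derives_of_reflTransGen {P : Set (Rule S)} {a : Atom S} {σ : Subst S.Const}
    {l : List (Atom S)} (h : Relation.ReflTransGen (InstanceStep P) [a.subst σ] l) :
    ∃ θ G γ, Derives P [a] θ G ∧ l = (G.map fun b => b.subst γ) ∧
      (θ.comp γ).AgreeOn σ a.vars := by
  induction h with
  | refl =>
    exact ⟨Subst.id, [a], σ, .refl, rfl, by rw [id_comp]; exact ⟨fun _ _ => rfl, fun _ _ => rfl⟩⟩
  | tail _ hs ih =>
    obtain ⟨θ, G, γ, hd, rfl, hσ⟩ := ih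
    obtain ⟨θ', G', γ', hd', hl, hγ'⟩ := hd.lift_instanceStep a.finite_vars hs
    exact ⟨θ', G', γ', hd', hl, hγ'.trans hσ⟩

/-! ### Soundness of SLD-resolution -/

theorem Resolves.sound {P : Set (Rule S)} (hP : ∀ r ∈ P, r.Safe) {G G' : List (Atom S)}
    {θ : Subst S.Const} (h : Resolves P G θ G') {I : Set (Atom S)}
    (hground : ∀ b ∈ I, b.IsGround) (hI : IsModel I P) {γ : Subst S.Const}
    (hG' : ∀ b ∈ G', b.subst γ ∈ I) : ∀ b ∈ G, b.subst (θ.comp γ) ∈ I := by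
  obtain ⟨r, hr, δ, -, -, L, R, a, rfl, hmgu, -, rfl⟩ := h
  have hmem : ∀ b ∈ L ++ (r.subst δ).body ++ R, b.subst (θ.comp γ) ∈ I := fun b hb => by
    rw [Atom.subst_comp]
    exact hG' _ (List.mem_map_of_mem hb)
  have hbody : ∀ b ∈ (r.subst (δ.comp (θ.comp γ))).body, b ∈ I := by
    intro b hb
    rw [Rule.subst_comp] at hb
    obtain ⟨c, hc, rfl⟩ := List.mem_map.mp hb
    exact hmem c (by simp [hc])
  have hvars : (r.subst (δ.comp (θ.comp γ))).vars = ∅ := by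
    rw [Rule.vars, Set.union_eq_left.mpr ((hP r hr).subst _), Set.eq_empty_iff_forall_notMem]
    rintro v ⟨b, hb, hv⟩
    have := hground b (hbody b hb)
    rw [Atom.IsGround] at this
    simp [this] at hv
  intro b hb
  rw [List.mem_append, List.mem_cons] at hb
  obtain hb | rfl | hb := hb
  · exact hmem b (by simp [hb])
  · have := hI r hr _ hvars hbody
    rwa [Rule.subst_comp, Rule.subst, Atom.subst_comp, ← hmgu.1, ← Atom.subst_comp] at this
  · exact hmem b (by simp [hb])

theorem Derives.sound {P : Set (Rule S)} (hP : ∀ r ∈ P, r.Safe) {G G' : List (Atom S)}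
    {θ : Subst S.Const} (h : Derives P G θ G') {I : Set (Atom S)}
    (hground : ∀ b ∈ I, b.IsGround) (hI : IsModel I P) {γ : Subst S.Const}
    (hG' : ∀ b ∈ G', b.subst γ ∈ I) : ∀ b ∈ G, b.subst (θ.comp γ) ∈ I := by
  induction h generalizing γ with
  | refl => simpa only [id_comp] using hG'
  | step _ hr ih =>
    rw [comp_assoc]
    exact ih (hr.sound hP hground hI hG')

theorem history_empty (τ : ℤ) : history (∅ : Set (Atom S)) τ = ∅ := by
  simp [history]

theorem prog_union_factRules_history_empty (Q : Query S) (τ : ℤ) :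
    Q.prog ∪ factRules (history ∅ τ) = Q.prog := by
  simp [history_empty, factRules]

/-- The premises of a computed answer entail the corresponding instance of the query. -/
theorem IsComputedWithPremises.entails {Q : Query S} {τ : ℤ} {θ : Subst S.Const}
    {A : Set (Atom S)} (h : IsComputedWithPremises Q ∅ τ θ A) (γ : Subst S.Const) :
    Entails Q.prog (substSet A γ) (Q.atom.subst (θ.comp γ)) := by
  obtain ⟨θ', G, hd, -, rfl, rfl⟩ := h
  rw [prog_union_factRules_history_empty] at hd
  intro I hground hI hA
  rw [Atom.subst_congr ((agreeOn_restrict θ' Q.atom.vars).comp γ)]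
  exact hd.sound Q.safe hground hI (fun b hb => hA ⟨b, hb, rfl⟩) _ (by simp)

theorem IsComputedWithPremises.finite {Q : Query S} {D : Set (Atom S)} {τ : ℤ}
    {θ : Subst S.Const} {A : Set (Atom S)} (h : IsComputedWithPremises Q D τ θ A) : A.Finite := by
  obtain ⟨-, G, -, -, -, rfl⟩ := h
  exact List.finite_toSet G

theorem IsComputedWithPremises.exists_minimal {Q : Query S} {θ : Subst S.Const}
    {A : Set (Atom S)} (h : IsComputedWithPremises Q ∅ (-1) θ A) :
    ∃ A' ⊆ A, IsMinimalComputed Q θ A' := by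
  have hfin : {B | B ⊆ A ∧ IsComputedWithPremises Q ∅ (-1) θ B}.Finite :=
    h.finite.finite_subsets.subset fun B hB => hB.1
  obtain ⟨B, hBA, hB⟩ := hfin.exists_le_minimal (a := A) ⟨subset_rfl, h⟩
  exact ⟨B, hBA, hB.prop.2, fun B' hB' hc => hB.eq_of_le ⟨hB'.trans hBA, hc⟩ hB'⟩

/-! ### Time variables in derivations of connected queries -/

theorem exists_time_of_time_mem_imageVars {σ : Subst C} {v : Var} {T : ℕ}
    (hT : Var.time T ∈ σ.imageVars v) : ∃ T₀, v = Var.time T₀ := by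
  cases v with
  | obj x =>
    simp only [imageVars] at hT
    cases hx : σ.obj x <;> simp [hx, OTerm.vars] at hT
  | time T₀ => exact ⟨T₀, rfl⟩

theorem eq_of_time_mem_imageVars {σ : Subst C} {v : Var} {T T' : ℕ}
    (hT : Var.time T ∈ σ.imageVars v) (hT' : Var.time T' ∈ σ.imageVars v) : T = T' := by
  cases v with
  | obj x =>
    simp only [imageVars] at hT
    cases hx : σ.obj x <;> simp [hx, OTerm.vars] at hT
  | time T₀ =>
    simp only [imageVars] at hT hT'
    cases hx : σ.time T₀ <;> simp_all [TTerm.vars]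

theorem Rule.Connected.time_mem_head_vars_subst {r : Rule S} (h : r.Connected)
    {δ : Subst S.Const} {T : ℕ} (hT : Var.time T ∈ goalVars (r.subst δ).body) :
    Var.time T ∈ (r.subst δ).head.vars := by
  obtain ⟨w, hw, hTw⟩ := mem_goalVars_map_subst.mp hT
  obtain ⟨T', rfl⟩ := exists_time_of_time_mem_imageVars hTw
  exact Atom.mem_vars_subst.mpr ⟨_, h.2 T' hw, hTw⟩

/-- At most one time variable occurs in `G`. -/
def AtMostOneTimeVar (G : List (Atom S)) : Prop :=
  ∀ T T', Var.time T ∈ goalVars G → Var.time T' ∈ goalVars G → T = T'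

/-- A resolution step with a connected rule introduces no time variable that is not in the
instance of the goal: the time variable of the body is unified with the time term of the selected
atom. -/
theorem Resolves.atMostOneTimeVar {P : Set (Rule S)} (hP : ∀ r ∈ P, r.Connected)
    {G G' : List (Atom S)} {θ : Subst S.Const} (h : Resolves P G θ G')
    (hG : AtMostOneTimeVar G) : AtMostOneTimeVar G' := by
  obtain ⟨r, hr, δ, -, -, L, R, a, rfl, hmgu, -, rfl⟩ := h
  have key : ∀ T, Var.time T ∈ goalVars ((L ++ (r.subst δ).body ++ R).map fun b => b.subst θ) →
      ∃ T₀, Var.time T₀ ∈ goalVars (L ++ a :: R) ∧ Var.time T ∈ θ.imageVars (.time T₀) := by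
    intro T hT
    suffices ∃ w ∈ goalVars (L ++ a :: R), Var.time T ∈ θ.imageVars w by
      obtain ⟨w, hw, hTw⟩ := this
      obtain ⟨T₀, rfl⟩ := exists_time_of_time_mem_imageVars hTw
      exact ⟨T₀, hw, hTw⟩
    obtain ⟨w, ⟨b, hb, hw⟩, hTw⟩ := mem_goalVars_map_subst.mp hT
    simp only [List.mem_append] at hb
    obtain (hb | hb) | hb := hb
    · exact ⟨w, ⟨b, by simp [hb], hw⟩, hTw⟩
    · obtain ⟨T₁, rfl⟩ := exists_time_of_time_mem_imageVars hTw
      have h1 : Var.time T₁ ∈ (r.subst δ).head.vars := (hP r hr).time_mem_head_vars_subst ⟨b, hb, hw⟩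
      have h2 : Var.time T ∈ (a.subst θ).vars := by
        rw [hmgu.1]
        exact Atom.mem_vars_subst.mpr ⟨_, h1, hTw⟩
      obtain ⟨u, hu, hTu⟩ := Atom.mem_vars_subst.mp h2
      exact ⟨u, ⟨a, by simp, hu⟩, hTu⟩
    · exact ⟨w, ⟨b, by simp [hb], hw⟩, hTw⟩
  intro T T' hT hT'
  obtain ⟨T₀, h₀, hT₀⟩ := key T hT
  obtain ⟨T₁, h₁, hT₁⟩ := key T' hT'
  obtain rfl := hG _ _ h₀ h₁
  exact eq_of_time_mem_imageVars hT₀ hT₁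

theorem Derives.atMostOneTimeVar {P : Set (Rule S)} (hP : ∀ r ∈ P, r.Connected)
    {G G' : List (Atom S)} {θ : Subst S.Const} (h : Derives P G θ G')
    (hG : AtMostOneTimeVar G) : AtMostOneTimeVar G' := by
  induction h with
  | refl => exact hG
  | step _ hr ih => exact hr.atMostOneTimeVar hP ih

theorem Atom.eq_of_time_mem_vars {a : Atom S} {T T' : ℕ} (hT : Var.time T ∈ a.vars)
    (hT' : Var.time T' ∈ a.vars) : T = T' := by
  have key : ∀ {T}, Var.time T ∈ a.vars → ∃ k, a.time = some (.shift T k) := by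
    rintro T (⟨t, ht, hv⟩ | ⟨t, ht, hv⟩)
    · cases t <;> simp [OTerm.vars] at hv
    · cases t with
      | const z => exact hv.elim
      | shift T' k =>
        cases hv
        exact ⟨k, ht⟩
  obtain ⟨k, hk⟩ := key hT
  obtain ⟨k', hk'⟩ := key hT'
  rw [hk] at hk'
  simp_all

theorem Atom.time_mem_vars {a : Atom S} {T : ℕ} {k : ℤ} (h : a.time = some (.shift T k)) :
    Var.time T ∈ a.vars := Or.inr ⟨_, h, rfl⟩

/-- All premises of an answer to a connected query use the same time variable. -/
theorem IsComputedWithPremises.time_var_unique {Q : Query S} (hconn : Q.Connected) {τ : ℤ}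
    {θ : Subst S.Const} {A : Set (Atom S)} (h : IsComputedWithPremises Q ∅ τ θ A)
    {a b : Atom S} (ha : a ∈ A) (hb : b ∈ A) {T T' : ℕ} {k k' : ℤ}
    (haT : a.time = some (.shift T k)) (hbT : b.time = some (.shift T' k')) : T = T' := by
  obtain ⟨θ', G, hd, -, rfl, rfl⟩ := h
  rw [prog_union_factRules_history_empty] at hd
  refine hd.atMostOneTimeVar hconn ?_ T T' ⟨a, ha, Atom.time_mem_vars haT⟩
    ⟨b, hb, Atom.time_mem_vars hbT⟩
  rintro T T' ⟨c, hc, hT⟩ ⟨d, hd, hT'⟩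
  rw [List.mem_singleton] at hc hd
  subst hc hd
  exact Atom.eq_of_time_mem_vars hT hT'

/-! ### Preconditions of a supported answer -/

/-- The set of atoms left over in a proof of a supported answer is all of `E ∪ H`, since both
sets are minimal. -/
theorem IsSupportedAnswer.eq_union_of_entails {Q : Query S} {D : Set (Atom S)} {τ : ℤ}
    {σ : Subst S.Const} {H E : Set (Atom S)} (h : IsSupportedAnswer Q D τ σ H E)
    {L : Set (Atom S)} (hL : L ⊆ E ∪ H) (hent : Entails Q.prog L (Q.atom.subst σ)) :
    L = E ∪ H := by
  have mono : ∀ {F : Set (Atom S)}, L ⊆ F → Entails Q.prog F (Q.atom.subst σ) :=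
    fun hLF I hI hm hF => hent I hI hm (hLF.trans hF)
  have hE : E ∩ L = E := h.minimal _ Set.inter_subset_left
    (mono fun a ha => (hL ha).imp (fun haE => ⟨haE, ha⟩) fun haH => haH)
  have hH : H ∩ L = H := h.hypothetical.minimal _ Set.inter_subset_left
    (mono fun a ha => (hL ha).imp (fun haE => h.subset haE) fun haH => ⟨haH, ha⟩)
  refine hL.antisymm (Set.union_subset ?_ ?_)
  · exact Set.inter_eq_left.mp hE
  · exact Set.inter_eq_left.mp hH

theorem IsSupportedAnswer.isGround {Q : Query S} {D : Set (Atom S)} {τ : ℤ}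
    {σ : Subst S.Const} {H E : Set (Atom S)} (h : IsSupportedAnswer Q D τ σ H E)
    (hD : IsDataset Q.prog D) : ∀ a ∈ E ∪ H, a.IsGround := by
  rintro a (ha | ha)
  · exact (hD a (h.subset ha).1).1
  · exact (h.hypothetical.edb a ha).1

theorem IsSupportedAnswer.isEDB {Q : Query S} {D : Set (Atom S)} {τ : ℤ}
    {σ : Subst S.Const} {H E : Set (Atom S)} (h : IsSupportedAnswer Q D τ σ H E)
    (hD : IsDataset Q.prog D) : ∀ a ∈ E ∪ H, IsEDB Q.prog a.pred := by
  rintro a (ha | ha)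
  · exact (hD a (h.subset ha).1).2.1
  · exact (h.hypothetical.edb a ha).2

theorem IsSupportedAnswer.exists_hasTimestamp {Q : Query S} {D : Set (Atom S)} {τ : ℤ}
    (hτ : 0 ≤ τ) {σ : Subst S.Const} {H E : Set (Atom S)} (h : IsSupportedAnswer Q D τ σ H E)
    (hD : IsDataset Q.prog D) : ∀ a ∈ E ∪ H, ∃ z, a.HasTimestamp z ∧ 0 ≤ z := by
  rintro a (ha | ha)
  · obtain ⟨haD, z, hz, -⟩ := h.subset ha
    exact ⟨z, hz, (hD a haD).2.2 z hz⟩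
  · obtain ⟨z, hz, hτz⟩ := h.hypothetical.future a ha
    exact ⟨z, hz, (hτ.trans_lt hτz).le⟩

theorem Atom.HasTimestamp.isFuture {a : Atom S} {γ : Subst S.Const} {z τ : ℤ}
    (h : (a.subst γ).HasTimestamp z) (hz : τ < z) : a.IsFuture τ := by
  obtain ⟨t, ht, htz⟩ := Option.map_eq_some_iff.mp h
  cases t with
  | const w =>
    cases htz
    exact Or.inr ⟨_, ht, hz⟩
  | shift T k => exact Or.inl ⟨T, k, ht⟩

theorem Atom.HasTimestamp.unique {a : Atom S} {z w : ℤ} (hz : a.HasTimestamp z)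
    (hw : a.HasTimestamp w) : z = w := by
  rw [Atom.HasTimestamp, hz] at hw
  simpa using hw

theorem Atom.HasTimestamp.subst {a : Atom S} {z : ℤ} (h : a.HasTimestamp z)
    (γ : Subst S.Const) : (a.subst γ).HasTimestamp z := by
  rw [Atom.HasTimestamp] at h ⊢
  simp [Atom.subst, h, TTerm.subst]

/-- Every supported answer is an instance of a minimal computed answer with premises that gives
rise to a precondition. -/
theorem IsSupportedAnswer.exists_precondition {Q : Query S} {PQ : Set (Triple S)}
    (hPQ : IsPreconditionSet Q PQ) {D : Set (Atom S)} (hD : IsDataset Q.prog D) {τ : ℤ}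
    (hτ : 0 ≤ τ) {σ : Subst S.Const} {H E : Set (Atom S)} (h : IsSupportedAnswer Q D τ σ H E) :
    ∃ θ A γ, IsMinimalComputed Q θ A ∧ (⟨θ, earliest A, A \ earliest A⟩ : Triple S) ∈ PQ ∧
      σ = (θ.comp γ).restrict Q.atom.vars ∧ substSet A γ = E ∪ H := by
  obtain ⟨l, hl, hsteps⟩ := h.entails.exists_reflTransGen_instanceStep (h.isGround hD)
  obtain ⟨θ₀, G, γ, hd, rfl, hθ₀⟩ := exists_derives_of_reflTransGen hsteps
  have hG : ∀ a ∈ G, a.subst γ ∈ E ∪ H := fun a ha => hl _ (List.mem_map_of_mem ha)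
  have hcomp : IsComputedWithPremises Q ∅ (-1) (θ₀.restrict Q.atom.vars) {a | a ∈ G} := by
    refine ⟨θ₀, G, by rwa [prog_union_factRules_history_empty], fun a ha => ⟨?_, ?_⟩, rfl, rfl⟩
    · obtain ⟨z, hz, h0⟩ := h.exists_hasTimestamp hτ hD _ (hG a ha)
      exact hz.isFuture (by omega)
    · exact h.isEDB hD (a.subst γ) (hG a ha)
  obtain ⟨A, hAG, hA⟩ := hcomp.exists_minimal
  have hagree : ((θ₀.restrict Q.atom.vars).comp γ).AgreeOn σ Q.atom.vars :=
    ((agreeOn_restrict _ _).comp γ).trans hθ₀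
  have hAγ : substSet A γ = E ∪ H := by
    refine h.eq_union_of_entails ?_ ?_
    · rintro _ ⟨a, ha, rfl⟩
      exact hG a (hAG ha)
    · rw [← Atom.subst_congr hagree]
      exact hA.1.entails γ
  obtain ⟨θ, A', hA', ⟨-, δ, hθ, rfl⟩, hmem⟩ := hPQ.2 _ _ hA
  refine ⟨θ, A', δ.comp γ, hA', hmem, ?_, ?_⟩
  · rw [← restrict_supp σ, h.hypothetical.supp_eq]
    refine restrict_congr ?_
    rw [hθ] at hagree
    rw [← comp_assoc]
    exact hagree.symm.trans ((agreeOn_restrict _ _).comp γ)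
  · rw [substSet_comp, hAγ]

/-! ### Answers over facts -/

theorem Atom.vars_subst_restrict {a : Atom S} {γ : Subst S.Const} {V : Set Var}
    (hγ : ∀ v ∈ V, γ.imageVars v = ∅) : (a.subst (γ.restrict V)).vars = a.vars \ V := by
  have hV : ∀ w ∈ V, (γ.restrict V).imageVars w = ∅ := by
    intro w hw
    rw [← hγ w hw]
    cases w <;> simp [imageVars, restrict, hw]
  have hV' : ∀ w ∉ V, (γ.restrict V).imageVars w = {w} := by
    intro w hw
    cases w <;> simp [imageVars, restrict, hw, OTerm.vars, TTerm.vars]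
  ext v
  rw [Atom.mem_vars_subst]
  constructor
  · rintro ⟨w, hw, hv⟩
    by_cases hwV : w ∈ V
    · rw [hV w hwV] at hv
      exact hv.elim
    · rw [hV' w hwV] at hv
      cases hv
      exact ⟨hw, hwV⟩
  · rintro ⟨hv, hvV⟩
    exact ⟨v, hv, by rw [hV' v hvV]; rfl⟩

theorem OTerm.subst_eq_self {t : OTerm C} (h : t.vars = ∅) (σ : Subst C) : t.subst σ = t := by
  cases t with
  | const c => rfl
  | var x => simp [OTerm.vars] at h

theorem TTerm.subst_eq_self {t : TTerm} (h : t.vars = ∅) (σ : Subst C) : t.subst σ = t := by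
  cases t with
  | const c => rfl
  | shift T k => simp [TTerm.vars] at h

theorem Subst.restrict_comp_restrict {γ : Subst C} {V W : Set Var}
    (hγ : ∀ v ∈ V, γ.imageVars v = ∅) :
    (γ.restrict V).comp (γ.restrict W) = γ.restrict (V ∪ W) := by
  ext1
  · funext x
    by_cases hx : Var.obj x ∈ V
    · simpa [comp, restrict, hx] using OTerm.subst_eq_self (hγ _ hx) (γ.restrict W)
    · by_cases hW : Var.obj x ∈ W <;> simp [comp, restrict, hx, hW, OTerm.subst]
  · funext T
    by_cases hT : Var.time T ∈ V
    · simpa [comp, restrict, hT] using TTerm.subst_eq_self (hγ _ hT) (γ.restrict W)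
    · by_cases hW : Var.time T ∈ W <;>
        simp [comp, restrict, hT, hW, TTerm.subst, TTerm.add_zero]

theorem Subst.restrict_comp {γ : Subst C} {V : Set Var} (hγ : ∀ v ∈ V, γ.imageVars v = ∅) :
    (γ.restrict V).comp γ = γ := by
  ext1
  · funext x
    by_cases hx : Var.obj x ∈ V
    · simpa [comp, restrict, hx] using OTerm.subst_eq_self (hγ _ hx) γ
    · simp [comp, restrict, hx, OTerm.subst]
  · funext T
    by_cases hT : Var.time T ∈ V
    · simpa [comp, restrict, hT] using TTerm.subst_eq_self (hγ _ hT) γ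
    · simp [comp, restrict, hT, TTerm.subst, TTerm.add_zero]

theorem imageVars_eq_empty {a : Atom S} {γ : Subst S.Const} (h : (a.subst γ).IsGround) :
    ∀ v ∈ a.vars, γ.imageVars v = ∅ := by
  intro v hv
  rw [Set.eq_empty_iff_forall_notMem]
  intro w hw
  have : w ∈ (a.subst γ).vars := Atom.mem_vars_subst.mpr ⟨v, hv, hw⟩
  rw [h] at this
  exact this

theorem Atom.subst_eq_self {a : Atom S} (h : a.IsGround) (σ : Subst S.Const) :
    a.subst σ = a := by
  refine (Atom.subst_congr (τ := Subst.id) ?_).trans (Atom.subst_id a)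
  rw [h]
  exact ⟨fun _ hx => hx.elim, fun _ hT => hT.elim⟩

/-- If `γ` maps a goal to facts, then the facts can be resolved away one by one, where the mgu of
each step is the restriction of `γ` to the variables of the selected atom. -/
theorem derives_factRules {F : Set (Atom S)} (hF : ∀ a ∈ F, a.IsGround) {γ : Subst S.Const} :
    ∀ (G K : List (Atom S)), (∀ a ∈ K ++ G, a.subst γ ∈ F) →
      Derives (factRules F) (K ++ G) (γ.restrict (goalVars K))
        (G.map fun a => a.subst (γ.restrict (goalVars K))) →
      Derives (factRules F) (K ++ G) (γ.restrict (goalVars (K ++ G))) []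
  | [], K, _, hd => by simpa using hd
  | a :: G, K, hFG, hd => by
    have hK : ∀ v ∈ goalVars K, γ.imageVars v = ∅ := by
      rintro v ⟨b, hb, hv⟩
      exact imageVars_eq_empty (hF _ (hFG b (by simp [hb]))) v hv
    have ha : a.subst γ ∈ F := hFG a (by simp)
    set b := a.subst (γ.restrict (goalVars K)) with hb
    have hbγ : b.subst γ = a.subst γ := by
      rw [hb, ← Atom.subst_comp, restrict_comp hK]
    have hbfact : b.subst (γ.restrict b.vars) = a.subst γ := by
      rw [← hbγ]
      exact Atom.subst_congr (agreeOn_restrict _ _)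
    have hbvars : ∀ v ∈ b.vars, γ.imageVars v = ∅ :=
      imageVars_eq_empty (hbγ ▸ hF _ ha)
    have hbimage : ∀ v ∈ b.vars, (γ.restrict b.vars).imageVars v = ∅ :=
      imageVars_eq_empty (hbfact ▸ hF _ ha)
    have hrestr : (γ.restrict (goalVars K)).comp (γ.restrict b.vars) =
        γ.restrict (goalVars (K ++ [a])) := by
      rw [restrict_comp_restrict hK, hb, Atom.vars_subst_restrict hK, Set.union_sdiff_self]
      congr 1
      ext v
      simp [goalVars, or_and_right, exists_or]
    have hvars : ((Rule.mk [] (a.subst γ)).subst Subst.id).vars = ∅ := by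
      have := hF _ ha
      simp only [Rule.vars, Rule.subst, List.map_nil, Atom.subst_id]
      rw [this]
      simp [goalVars]
    have hstep : Resolves (factRules F) (b :: G.map fun c => c.subst (γ.restrict (goalVars K)))
        (γ.restrict b.vars) (G.map fun c => c.subst (γ.restrict (goalVars (K ++ [a])))) := by
      refine ⟨⟨[], a.subst γ⟩, ⟨_, ha, rfl⟩, Subst.id, ⟨⟨1, fun _ => rfl⟩, 1, fun _ => rfl⟩, ?_,
        [], _, b, rfl, ⟨?_, fun τ hτ => ⟨τ, ?_⟩⟩, ?_, ?_⟩
      · rw [hvars]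
        exact Set.disjoint_empty _
      · simp only [Rule.subst, Atom.subst_id]
        rw [hbfact, Atom.subst_eq_self (hF _ ha)]
      · -- A unifier of `b` with the fact agrees with `γ` on the variables of `b`.
        simp only [Rule.subst, Atom.subst_id] at hτ
        rw [Atom.subst_eq_self (hF _ ha), ← hbγ] at hτ
        rw [← restrict_congr (AgreeOn.of_atom_subst_eq hτ)]
        refine (restrict_comp fun v hv => ?_).symm
        exact imageVars_eq_empty (a := b) (by rw [hτ, hbγ]; exact hF _ ha) v hv
      · intro v hv
        by_cases hvb : v ∈ b.vars
        · rw [hbimage v hvb]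
          exact Set.empty_subset _
        · cases v <;> simp [supp, restrict, hvb] at hv
      · simp [Rule.subst, Function.comp_def, ← Atom.subst_comp, hrestr]
    have hd' := hd.step hstep
    rw [hrestr] at hd'
    have := derives_factRules hF G (K ++ [a]) (by simpa using hFG) (by simpa using hd')
    simpa using this

theorem isComputedAnswerSet_restrict {F : Set (Atom S)} (hF : ∀ a ∈ F, a.IsGround)
    {γ : Subst S.Const} {M : Set (Atom S)} (hM : M.Finite) (hMF : ∀ a ∈ M, a.subst γ ∈ F) :
    IsComputedAnswerSet (factRules F) M (γ.restrict (⋃ a ∈ M, a.vars)) := by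
  have hG : ∀ a, a ∈ hM.toFinset.toList ↔ a ∈ M := by simp
  have hvars : goalVars hM.toFinset.toList = ⋃ a ∈ M, a.vars := by
    ext v
    simp [goalVars]
  refine ⟨hM.toFinset.toList, Finset.nodup_toList _, Set.ext hG, _,
    derives_factRules hF hM.toFinset.toList [] (fun a ha => hMF a ((hG a).mp ha)) ?_, ?_⟩
  · have : γ.restrict (goalVars ([] : List (Atom S))) = Subst.id := by
      ext1 <;> simp [restrict, goalVars, Subst.id]
    simpa [this, Atom.subst_id] using Derives.refl
  · rw [List.nil_append, hvars]
    exact (restrict_congr (agreeOn_restrict _ _)).symm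

/-! ### The run of the algorithm -/

/-- The state of the algorithm at time `t` on the way to the set `L` of facts: `s` is a schematic
answer whose instance under `γ` splits `L` into the facts up to time `t` and the later ones. -/
structure Tracks (θ γ : Subst S.Const) (L : Set (Atom S)) (t : ℤ) (s : Triple S) : Prop where
  subst_eq : s.subst.comp γ = θ.comp γ
  finite : s.snd.Finite
  hasTimestamp : ∀ a ∈ s.snd, ∃ z, a.HasTimestamp z
  fst_eq : substSet s.fst γ = history L t
  snd_eq : substSet s.snd γ = L \ history L t

theorem substSet_restrict_comp {γ : Subst S.Const} {V : Set Var}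
    (hγ : ∀ v ∈ V, γ.imageVars v = ∅) (A : Set (Atom S)) :
    substSet (substSet A (γ.restrict V)) γ = substSet A γ := by
  rw [← substSet_comp, restrict_comp hγ]

theorem imageVars_biUnion_eq_empty {γ : Subst S.Const} {M : Set (Atom S)}
    (hM : ∀ a ∈ M, (a.subst γ).IsGround) : ∀ v ∈ ⋃ a ∈ M, a.vars, γ.imageVars v = ∅ := by
  intro v hv
  obtain ⟨a, ha, hv⟩ := Set.mem_iUnion₂.mp hv
  exact imageVars_eq_empty (hM a ha) v hv

theorem history_succ (L : Set (Atom S)) (t : ℤ) :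
    history L (t + 1) = history L t ∪ {a | a ∈ L ∧ a.HasTimestamp (t + 1)} := by
  ext a
  constructor
  · rintro ⟨ha, z, hz, hzt⟩
    rcases hzt.eq_or_lt with rfl | hzt
    · exact Or.inr ⟨ha, hz⟩
    · exact Or.inl ⟨ha, z, hz, by omega⟩
  · rintro (⟨ha, z, hz, hzt⟩ | ⟨ha, hz⟩)
    · exact ⟨ha, z, hz, by omega⟩
    · exact ⟨ha, _, hz, le_rfl⟩

theorem mem_history_diff {D : Set (Atom S)} {a : Atom S} {t : ℤ} (ha : a ∈ D)
    (hat : a.HasTimestamp t) : a ∈ history D t \ history D (t - 1) := by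
  refine ⟨⟨ha, t, hat, le_rfl⟩, ?_⟩
  rintro ⟨-, z, hz, hzt⟩
  have := hz.unique hat
  omega

/-- One round updates a schematic answer with the facts of `L` that arrive. -/
theorem Tracks.exists_round {PQ prev : Set (Triple S)} {D L : Set (Atom S)}
    (hDground : ∀ a ∈ D, a.IsGround) {θ γ : Subst S.Const} {t : ℤ}
    (hL : ∀ a ∈ L, a.HasTimestamp (t + 1) → a ∈ D) {s : Triple S} (hs : s ∈ prev)
    (h : Tracks θ γ L t s) :
    ∃ s' ∈ round PQ prev (history D (t + 1) \ history D t) (t + 1),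
      Tracks θ γ L (t + 1) s' := by
  set M := {a | a ∈ s.snd ∧ a.HasTimestamp (t + 1)} with hM
  have hML : substSet M γ = {a | a ∈ L ∧ a.HasTimestamp (t + 1)} := by
    ext a
    constructor
    · rintro ⟨b, ⟨hb, hbt⟩, rfl⟩
      have : b.subst γ ∈ L \ history L t := h.snd_eq ▸ ⟨b, hb, rfl⟩
      exact ⟨this.1, hbt.subst γ⟩
    · rintro ⟨haL, hat⟩
      have : a ∈ substSet s.snd γ := by
        rw [h.snd_eq]
        refine ⟨haL, ?_⟩
        rintro ⟨-, z, hz, hzt⟩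
        have := hz.unique hat
        omega
      obtain ⟨b, hb, rfl⟩ := this
      obtain ⟨z, hz⟩ := h.hasTimestamp b hb
      obtain rfl := (hz.subst γ).unique hat
      exact ⟨b, ⟨hb, hz⟩, rfl⟩
  have hMF : ∀ a ∈ M, a.subst γ ∈ history D (t + 1) \ history D t := by
    intro a ha
    have : a.subst γ ∈ substSet M γ := ⟨a, ha, rfl⟩
    rw [hML] at this
    simpa using mem_history_diff (hL _ this.1 this.2) this.2
  have hγ := imageVars_biUnion_eq_empty fun a ha => hDground _ (hMF a ha).1.1
  have hMfin : M.Finite := h.finite.subset fun a ha => ha.1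
  refine ⟨_, Or.inr ⟨s, hs, M, hM, _, isComputedAnswerSet_restrict
    (fun a ha => hDground a ha.1.1) hMfin hMF, rfl⟩, ?_, ?_, ?_, ?_, ?_⟩
  · rw [comp_assoc, restrict_comp hγ, h.subst_eq]
  · exact (h.finite.subset Set.sdiff_subset).image _
  · rintro _ ⟨a, ha, rfl⟩
    obtain ⟨z, hz⟩ := h.hasTimestamp a ha.1
    exact ⟨z, hz.subst _⟩
  · rw [substSet_restrict_comp hγ, substSet, Set.image_union, ← substSet, ← substSet, h.fst_eq,
      hML, ← history_succ]
  · rw [substSet_restrict_comp hγ, history_succ]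
    ext a
    constructor
    · rintro ⟨b, ⟨hb, hbM⟩, rfl⟩
      have hbL : b.subst γ ∈ L \ history L t := h.snd_eq ▸ ⟨b, hb, rfl⟩
      refine ⟨hbL.1, ?_⟩
      rintro (hbt | ⟨-, hbt⟩)
      · exact hbL.2 hbt
      · obtain ⟨z, hz⟩ := h.hasTimestamp b hb
        obtain rfl := (hz.subst γ).unique hbt
        exact hbM ⟨hb, hz⟩
    · rintro ⟨haL, ha⟩
      have : a ∈ substSet s.snd γ := h.snd_eq ▸ ⟨haL, fun h => ha (Or.inl h)⟩
      obtain ⟨b, hb, rfl⟩ := this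
      exact ⟨b, ⟨hb, fun hbM => ha (Or.inr ⟨haL, hbM.2.subst γ⟩)⟩, rfl⟩

theorem exists_schematic_eq_round (PQ : Set (Triple S)) (D : Set (Atom S)) (n : ℕ) :
    ∃ prev, schematic PQ D n = round PQ prev (history D n \ history D ((n : ℤ) - 1)) n := by
  cases n with
  | zero => exact ⟨∅, by simp [schematic]⟩
  | succ n => exact ⟨schematic PQ D n, by simp [schematic]⟩

/-- The substitution `γ` orders the time terms of premises as they are ordered symbolically. -/
theorem IsMinimalComputed.timeLE_iff {Q : Query S} (hconn : Q.Connected)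
    (hunmixed : Q.UnmixedPremises) {θ : Subst S.Const} {A : Set (Atom S)}
    (hA : IsMinimalComputed Q θ A) {γ : Subst S.Const} {a b : Atom S} (ha : a ∈ A) (hb : b ∈ A)
    {z w : ℤ} (hz : (a.subst γ).HasTimestamp z) (hw : (b.subst γ).HasTimestamp w) :
    a.TimeLE b ↔ z ≤ w := by
  rcases hunmixed θ A hA with hconst | hshift
  · obtain ⟨z', hz'⟩ := hconst a ha
    obtain ⟨w', hw'⟩ := hconst b hb
    obtain rfl := (Atom.HasTimestamp.subst hz' γ).unique hz
    obtain rfl := (Atom.HasTimestamp.subst hw' γ).unique hw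
    simp [Atom.TimeLE, hz', hw']
  · obtain ⟨T, k, hk⟩ := hshift a ha
    obtain ⟨T', l, hl⟩ := hshift b hb
    obtain rfl := hA.1.time_var_unique hconn ha hb hk hl
    simp only [Atom.HasTimestamp, Atom.subst, hk, hl, Option.map_some, Option.some.injEq,
      TTerm.subst] at hz hw
    cases hT : γ.time T with
    | const c =>
      simp only [hT, TTerm.add, TTerm.const.injEq] at hz hw
      simp only [Atom.TimeLE, hk, hl, Option.some.injEq, reduceCtorEq, false_and, exists_false,
        TTerm.shift.injEq, false_or]
      constructor
      · rintro ⟨T', k', l', ⟨-, rfl⟩, ⟨-, rfl⟩, h⟩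
        omega
      · intro h
        exact ⟨T, k, l, ⟨rfl, rfl⟩, ⟨rfl, rfl⟩, by omega⟩
    | shift T' k' => simp [hT, TTerm.add] at hz

/-- The round at the minimal timestamp of `L` turns the precondition for `L` into a schematic
answer without time variables. -/
theorem IsMinimalComputed.exists_schematic {Q : Query S} (hconn : Q.Connected)
    (hunmixed : Q.UnmixedPremises) {PQ : Set (Triple S)} {θ : Subst S.Const} {A : Set (Atom S)}
    (hA : IsMinimalComputed Q θ A)
    (hmem : (⟨θ, earliest A, A \ earliest A⟩ : Triple S) ∈ PQ)
    {D L : Set (Atom S)} (hDground : ∀ a ∈ D, a.IsGround) {γ : Subst S.Const}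
    (hAL : substSet A γ = L) (hLtime : ∀ a ∈ L, ∃ z, a.HasTimestamp z ∧ 0 ≤ z) {τ : ℕ}
    (hLD : ∀ a ∈ L, ∀ z, a.HasTimestamp z → z ≤ τ → a ∈ D)
    (hLne : (history L τ).Nonempty) :
    ∃ n ≤ τ, ∃ s ∈ schematic PQ D n, Tracks θ γ L n s := by
  have hAγ : ∀ a ∈ A, a.subst γ ∈ L := fun a ha => hAL ▸ ⟨a, ha, rfl⟩
  -- `n` is the least timestamp in `L`.
  obtain ⟨n, ⟨a₀, ha₀, ha₀n⟩, hmin⟩ : ∃ n : ℕ, (∃ a ∈ L, a.HasTimestamp n) ∧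
      ∀ a ∈ L, ∀ z, a.HasTimestamp z → (n : ℤ) ≤ z := by
    classical
    have hex : ∃ n : ℕ, ∃ a ∈ L, a.HasTimestamp n := by
      obtain ⟨a, ha, -⟩ := hLne
      obtain ⟨z, hz, h0⟩ := hLtime a ha
      lift z to ℕ using h0
      exact ⟨z, a, ha, hz⟩
    refine ⟨Nat.find hex, Nat.find_spec hex, fun a ha z hz => ?_⟩
    obtain ⟨z', hz', h0⟩ := hLtime a ha
    obtain rfl := hz'.unique hz
    lift z' to ℕ using h0
    exact_mod_cast Nat.find_min' hex ⟨a, ha, hz⟩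
  have hnτ : n ≤ τ := by
    obtain ⟨a, ha, z, hz, hzτ⟩ := hLne
    exact_mod_cast (hmin a ha z hz).trans hzτ
  rw [← hAL] at ha₀
  obtain ⟨b₀, hb₀, rfl⟩ := ha₀
  have hearliest : ∀ a, a ∈ earliest A ↔ a ∈ A ∧ (a.subst γ).HasTimestamp n := by
    intro a
    refine and_congr_right fun ha => ⟨fun h => ?_, fun h b hb => ?_⟩
    · obtain ⟨z, hz, -⟩ := hLtime _ (hAγ a ha)
      have h1 := (hA.timeLE_iff hconn hunmixed ha hb₀ hz ha₀n).mp (h b₀ hb₀)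
      have h2 := hmin _ (hAγ a ha) z hz
      exact (le_antisymm h1 h2) ▸ hz
    · obtain ⟨z, hz, -⟩ := hLtime _ (hAγ b hb)
      exact (hA.timeLE_iff hconn hunmixed ha hb h hz).mpr (hmin _ (hAγ b hb) z hz)
  have hMhist : substSet (earliest A) γ = history L n := by
    ext a
    constructor
    · rintro ⟨b, hb, rfl⟩
      obtain ⟨hb, hbn⟩ := (hearliest b).mp hb
      exact ⟨hAγ b hb, n, hbn, le_rfl⟩
    · rintro ⟨haL, z, hz, hzn⟩
      obtain rfl := le_antisymm hzn (hmin a haL z hz)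
      rw [← hAL] at haL
      obtain ⟨b, hb, rfl⟩ := haL
      exact ⟨b, (hearliest b).mpr ⟨hb, hz⟩, rfl⟩
  have hMF : ∀ a ∈ earliest A, a.subst γ ∈ history D n \ history D ((n : ℤ) - 1) := by
    intro a ha
    obtain ⟨ha, han⟩ := (hearliest a).mp ha
    exact mem_history_diff (hLD _ (hAγ a ha) _ han (by exact_mod_cast hnτ)) han
  have hγ := imageVars_biUnion_eq_empty fun a ha => hDground _ (hMF a ha).1.1
  have hMfin : (earliest A).Finite := hA.1.finite.subset fun a ha => ha.1
  obtain ⟨prev, hprev⟩ := exists_schematic_eq_round PQ D n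
  refine ⟨n, hnτ, ?_⟩
  rw [hprev]
  refine ⟨_, Or.inl ⟨_, hmem, _, isComputedAnswerSet_restrict
    (fun a ha => hDground a ha.1.1) hMfin hMF, rfl⟩, ?_, ?_, ?_, ?_, ?_⟩
  · rw [comp_assoc, restrict_comp hγ]
  · exact (hA.1.finite.subset Set.sdiff_subset).image _
  · rintro _ ⟨a, ha, rfl⟩
    rcases hunmixed θ A hA with hconst | hshift
    · obtain ⟨z, hz⟩ := hconst a ha.1
      exact ⟨z, Atom.HasTimestamp.subst hz _⟩
    · -- The only time variable of `A` occurs in the earliest premises, which became facts.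
      obtain ⟨T, k, hk⟩ := hshift a ha.1
      obtain ⟨T', l, hl⟩ := hshift b₀ hb₀
      obtain rfl := hA.1.time_var_unique hconn ha.1 hb₀ hk hl
      have hT : Var.time T ∈ ⋃ a ∈ earliest A, a.vars :=
        Set.mem_biUnion ((hearliest b₀).mpr ⟨hb₀, ha₀n⟩) (Atom.time_mem_vars hl)
      have hγT := hγ _ hT
      simp only [imageVars] at hγT
      cases hc : γ.time T with
      | const c => exact ⟨c + k, by simp [Atom.HasTimestamp, Atom.subst, hk, TTerm.subst,
          restrict, hT, hc, TTerm.add, -Set.mem_iUnion]⟩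
      | shift T' k' => simp [hc, TTerm.vars] at hγT
  · rw [substSet_restrict_comp hγ, hMhist]
  · rw [substSet_restrict_comp hγ]
    ext a
    constructor
    · rintro ⟨b, ⟨hb, hbM⟩, rfl⟩
      refine ⟨hAγ b hb, ?_⟩
      rintro ⟨-, z, hz, hzn⟩
      obtain rfl := le_antisymm hzn (hmin _ (hAγ b hb) z hz)
      exact hbM ((hearliest b).mpr ⟨hb, hz⟩)
    · rintro ⟨haL, ha⟩
      rw [← hMhist] at ha
      rw [← hAL] at haL
      obtain ⟨b, hb, rfl⟩ := haL
      exact ⟨b, ⟨hb, fun hbM => ha ⟨b, hbM, rfl⟩⟩, rfl⟩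

theorem Tracks.exists_schematic {PQ : Set (Triple S)} {D L : Set (Atom S)}
    (hDground : ∀ a ∈ D, a.IsGround) {θ γ : Subst S.Const} {τ : ℕ}
    (hLD : ∀ a ∈ L, ∀ z, a.HasTimestamp z → z ≤ τ → a ∈ D) {n : ℕ} (hn : n ≤ τ)
    {s : Triple S} (hs : s ∈ schematic PQ D n) (h : Tracks θ γ L n s) :
    ∃ s' ∈ schematic PQ D τ, Tracks θ γ L τ s' := by
  suffices ∀ m, n ≤ m → m ≤ τ → ∃ s' ∈ schematic PQ D m, Tracks θ γ L m s' from
    this τ hn le_rfl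
  intro m hnm
  induction m, hnm using Nat.le_induction with
  | base => exact fun _ => ⟨s, hs, h⟩
  | succ m _ ih =>
    intro hm
    obtain ⟨s', hs', h'⟩ := ih (by omega)
    obtain ⟨s'', hs'', h''⟩ := h'.exists_round (PQ := PQ) hDground
      (fun a ha hat => hLD a ha _ hat (by exact_mod_cast hm)) hs'
    exact ⟨s'', hs'', by exact_mod_cast h''⟩

end TemporalDatalog

theorem mainTheorem3 {S : TemporalDatalog.Signature} (Q : TemporalDatalog.Query S)
    (hconn : Q.Connected) (hunmixed : Q.UnmixedPremises)
    (PQ : Set (TemporalDatalog.Triple S)) (hPQ : TemporalDatalog.IsPreconditionSet Q PQ)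
    (D : Set (TemporalDatalog.Atom S)) (hD : TemporalDatalog.IsDataset Q.prog D) (τ : ℕ)
    (σ : TemporalDatalog.Subst S.Const) (H E : Set (TemporalDatalog.Atom S))
    (hσ : TemporalDatalog.IsSupportedAnswer Q D τ σ H E) :
    ∃ ρ : TemporalDatalog.Subst S.Const, ∃ θ E' H',
      (⟨θ, E', H'⟩ : TemporalDatalog.Triple S) ∈ TemporalDatalog.schematic PQ D τ ∧
        σ = (θ.comp ρ).restrict Q.atom.vars ∧
        H = TemporalDatalog.substSet H' ρ ∧ E = TemporalDatalog.substSet E' ρ := by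
  obtain ⟨θ, A, γ, hA, hmem, hθ, hAL⟩ := hσ.exists_precondition hPQ hD (Int.natCast_nonneg τ)
  have hhist : TemporalDatalog.history (E ∪ H) τ = E := by
    ext a
    constructor
    · rintro ⟨ha | ha, z, hz, hzτ⟩
      · exact ha
      · obtain ⟨w, hw, hτw⟩ := hσ.hypothetical.future a ha
        have := hw.unique hz
        omega
    · intro ha
      exact ⟨Or.inl ha, (hσ.subset ha).2⟩
  have hdiff : (E ∪ H) \ TemporalDatalog.history (E ∪ H) τ = H := by
    rw [hhist, Set.union_sdiff_left, sdiff_eq_left, Set.disjoint_left]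
    intro a haH haE
    rw [← hhist] at haE
    obtain ⟨-, z, hz, hzτ⟩ := haE
    obtain ⟨w, hw, hτw⟩ := hσ.hypothetical.future a haH
    have := hw.unique hz
    omega
  have hLD : ∀ a ∈ E ∪ H, ∀ z, a.HasTimestamp z → z ≤ (τ : ℤ) → a ∈ D := by
    intro a ha z hz hzτ
    have haE : a ∈ TemporalDatalog.history (E ∪ H) τ := ⟨ha, z, hz, hzτ⟩
    rw [hhist] at haE
    exact (hσ.subset haE).1
  obtain ⟨n, hn, s, hs, htracks⟩ := hA.exists_schematic hconn hunmixed hmem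
    (fun a ha => (hD a ha).1) hAL (hσ.exists_hasTimestamp (Int.natCast_nonneg τ) hD) hLD
    (by rw [hhist]; exact hσ.nonempty)
  obtain ⟨s', hs', h'⟩ := htracks.exists_schematic (fun a ha => (hD a ha).1) hLD hn hs
  refine ⟨γ, s'.subst, s'.fst, s'.snd, hs', ?_, ?_, ?_⟩
  · rw [h'.subst_eq, hθ]
  · rw [h'.snd_eq, hdiff]
  · rw [h'.fst_eq, hhist]
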